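/- **Theorem 1 (Two-line parking without screening).** Every site $i\in\mathbb Z$ has a state $m_i\in\{0,1,2,3\}$: $0$ if $i$ is vacant in both lines, $1$ if it is occupied in the first line only, $2$ if it is occupied in the second line only, $3$ if it is occupied in both lines. At time $0$ all sites are vacant. At each site cars arrive at the times of a Poisson process of rate one, independently for different sites; $N_i(t)$ denotes the number of arrivals at $i$ up to time $t$. When a car arrives at $i$, the state $m_i$ changes according to the states $(m_{i-1},m_i,m_{i+1})$ just before the arrival: it becomes $1$ if $(m_{i-1},m_i,m_{i+1})\in\{(0,0,0),(2,0,0),(0,0,2),(2,0,2)\}$, it becomes $2$ if $(m_{i-1},m_i,m_{i+1})\in\{(1,0,0),(0,0,1),(1,0,1)\}$, it becomes $3$ if $(m_{i-1},m_i,m_{i+1})=(0,1,0)$, and it is unchanged in all other cases. Let $P_t$ be the law at time $t$ and put $$D_t(s)=P_t(m_0=s),\qquad D_t(a,b,c)=P_t(m_{-1}=a,\,m_0=b,\,m_1=c),$$ $$f_t(s)=P_t(m_1=s\mid N_0(t)=0)\quad(s=0,1,2),\qquad R_t=P_t(m_1=1,\,m_2=0\mid N_0(t)=0).$$ Then for all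 $t\ge 0$ (with one-sided derivatives at $t=0$) $$\begin{aligned} \tfrac{d}{dt}D_t(0)&=-(f_t(0)+f_t(2))^2e^{-t}-(2f_t(0)f_t(1)+f_t(1)^2)e^{-t},\\ \tfrac{d}{dt}D_t(1)&=(f_t(0)+f_t(2))^2e^{-t}-D_t(0,1,0),\\ \tfrac{d}{dt}D_t(2)&=(2f_t(0)f_t(1)+f_t(1)^2)e^{-t},\\ \tfrac{d}{dt}D_t(3)&=D_t(0,1,0), \end{aligned}$$ with $D_0(0)=1$ and $D_0(1)=D_0(2)=D_0(3)=0$; the vector $(f_t(0),f_t(1),f_t(2),R_t)$ satisfies the linear system $$\begin{aligned} \tfrac{d}{dt}f_t(0)&=-f_t(0)e^{-t}-f_t(1)e^{-t}-f_t(2)e^{-t},\\ \tfrac{d}{dt}f_t(1)&=f_t(0)e^{-t}+f_t(2)e^{-t}-R_t,\\ \tfrac{d}{dt}f_t(2)&=f_t(1)e^{-t},\\ \tfrac{d}{dt}R_t&=f_t(0)\,(e^{-t}-te^{-2t})-f_t(1)\,te^{-2t}-R_t, \end{aligned}$$ with initial value $(f_0(0),f_0(1),f_0(2),R_0)=(1,0,0,0)$;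 and $$\tfrac{d}{dt}D_t(0,1,0)=f_t(0)^2e^{-t}-D_t(0,1,0)-2R_tf_t(0)e^{-t}-2R_tf_t(1)e^{-t},\qquad D_0(0,1,0)=0.$$ -/

import Mathlib

open MeasureTheory ProbabilityTheory
open scoped NNReal

noncomputable section

namespace TwoLineParking

/-- The state of a site: `0` vacant in both lines, `1` occupied in the first line only,
`2` occupied in the second line only, `3` occupied in both lines.

`rate s l c r` is the rate at which a site in state `c`, with left neighbour in state `l` and right
neighbour in state `r`, jumps to state `s`, in the model without screening. The first four
entries add a car in the first line, the next three add a car in the second line at a site whose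
first line is empty, the last one adds a car in the second line above a car in the first line. -/
def rate (s l c r : Fin 4) : ℕ :=
  if (s, l, c, r) ∈ ([(1, 0, 0, 0), (1, 2, 0, 0), (1, 0, 0, 2), (1, 2, 0, 2),
      (2, 1, 0, 0), (2, 0, 0, 1), (2, 1, 0, 1),
      (3, 0, 1, 0)] : List (Fin 4 × Fin 4 × Fin 4 × Fin 4)) then 1 else 0

/-- The new state of a site in state `c` with neighbours in states `l` and `r` when a car arrives
there: the car makes the site jump to the state allowed by `rate`, if there is one, and is
discarded otherwise. -/
def arrive (l c r : Fin 4) : Fin 4 :=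
  if rate 1 l c r = 1 then 1
  else if rate 2 l c r = 1 then 2
  else if rate 3 l c r = 1 then 3
  else c

/-- When cars arrive at rate one, the jump rates of the resulting dynamics are those of `rate`. -/
theorem rate_eq_arrive (s l c r : Fin 4) :
    rate s l c r = if s ≠ c ∧ arrive l c r = s then 1 else 0 := by
  revert s l c r
  decide

variable {Ω : Type*} [MeasurableSpace Ω]

/-- A Poisson counting process of rate one. -/
structure IsPoissonProcess (P : Measure Ω) (X : ℝ≥0 → Ω → ℕ) : Prop where
  measurable : ∀ t, Measurable (X t)
  zero : ∀ᵐ ω ∂P, X 0 ω = 0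
  monotone : ∀ᵐ ω ∂P, Monotone fun t => X t ω
  rightCts : ∀ᵐ ω ∂P, ∀ t, ContinuousWithinAt (fun u => X u ω) (Set.Ici t) t
  indepIncrements : HasIndepIncrements X P
  increment_law : ∀ s t, s ≤ t → HasLaw (fun ω => X t ω - X s ω) (poissonMeasure (t - s)) P

/-- `x i t` is the state of site `i` at time `t` when the number of cars that arrived at site
`i` up to time `t` is `n i t` and the lattice is vacant at time `0`. The state of a site
does not change while no car arrives there, and it changes according to `arrive` when one car
arrives there. -/
structure IsParkingPath (n : ℤ → ℝ≥0 → ℕ) (x : ℤ → ℝ≥0 → Fin 4) : Prop where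
  start : ∀ i, x i 0 = 0
  noArrival : ∀ i s t, s ≤ t → n i t = n i s → x i t = x i s
  oneArrival : ∀ i s t, s ≤ t → n i t = n i s + 1 →
    n (i - 1) t = n (i - 1) s → n (i + 1) t = n (i + 1) s →
    x i t = arrive (x (i - 1) s) (x i s) (x (i + 1) s)

/-- `m i t` is the state of site `i` at time `t` in the two-line parking process on `ℤ` without
screening, started from the vacant lattice, and `N i t` is the number of cars that arrived at site
`i` up to time `t`: cars arrive at the sites according to independent Poisson processes of rate
one. -/
structure IsParkingProcess (P : Measure Ω) (N : ℤ → ℝ≥0 → Ω → ℕ) (m : ℤ → ℝ≥0 → Ω → Fin 4) :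
    Prop where
  poisson : ∀ i, IsPoissonProcess P (N i)
  indep : iIndepFun (fun i ω => fun t => N i t ω) P
  measurable : ∀ i t, Measurable (m i t)
  path : ∀ᵐ ω ∂P, IsParkingPath (fun i t => N i t ω) (fun i t => m i t ω)

/-- `D_t(s) = P(m_0(t) = s)`. Time is a real number here so that derivatives make sense;
only `0 ≤ t` matters. -/
def D (P : Measure Ω) (m : ℤ → ℝ≥0 → Ω → Fin 4) (s : Fin 4) (t : ℝ) : ℝ :=
  P.real {ω | m 0 t.toNNReal ω = s}

/-- `D_t(a, b, c) = P(m_{-1}(t) = a, m_0(t) = b, m_1(t) = c)`. -/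
def D₃ (P : Measure Ω) (m : ℤ → ℝ≥0 → Ω → Fin 4) (a b c : Fin 4) (t : ℝ) : ℝ :=
  P.real {ω | m (-1) t.toNNReal ω = a ∧ m 0 t.toNNReal ω = b ∧ m 1 t.toNNReal ω = c}

/-- `f_t(s) = P(m_1(t) = s | N_0(t) = 0)`. -/
def f (P : Measure Ω) (N : ℤ → ℝ≥0 → Ω → ℕ) (m : ℤ → ℝ≥0 → Ω → Fin 4) (s : Fin 4) (t : ℝ) : ℝ :=
  (P[|{ω | N 0 t.toNNReal ω = 0}]).real {ω | m 1 t.toNNReal ω = s}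

/-- `R_t = P(m_1(t) = 1, m_2(t) = 0 | N_0(t) = 0)`. -/
def R (P : Measure Ω) (N : ℤ → ℝ≥0 → Ω → ℕ) (m : ℤ → ℝ≥0 → Ω → Fin 4) (t : ℝ) : ℝ :=
  (P[|{ω | N 0 t.toNNReal ω = 0}]).real {ω | m 1 t.toNNReal ω = 1 ∧ m 2 t.toNNReal ω = 0}

end TwoLineParking

end

/-! The theorem combines one evolution equation with three facts about the configuration at a fixed
time.

Evolution (`IsParkingProcess.hasDerivWithinAt`): for an event `A` depending on finitely many sites,
the derivative of its probability is the sum over those sites of the probability that a car there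
leads into `A`, minus the probability of `A`. Everything else consists of evaluating such sums
without producing unknown densities of longer blocks.

The three facts are these. A site without arrivals is vacant, while a vacant site that has rejected
a car rejects all later ones (`IsParkingProcess.ae_blocked`); hence a car parks at a vacant site
only if no car came there before. A site without arrivals separates the lattice: conditionally on `N
a t = 0`, the two half-lines beside `a` are independent mirror images
(`IsParkingProcess.measureReal_split`). So every gain or loss at a vacant site factors into `f`, `R`
and powers of `exp (-t)`. Finally, between two sites without arrivals, state `1` means exactly one
arrival (`IsParkingProcess.ae_isolated`). This closes the equation for `R`: the event it needs has
the explicit Poisson weight `t * exp (-t)` at the middle site.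

The process is given only through path properties over intervals with at most one arrival at the
site concerned, so its dependence on the arrivals has to be recovered. This is done by `grid`, a
synchronous discrete-time model driven by the Poisson increments over a fine mesh. It is a
measurable function of independent variables, so independence, reflection and blocking can be proved
there directly. Sites without arrivals act as walls on both sides of a given site, and on a fine
mesh the finite window between them rarely sees two arrivals in one step; thus the two models agree
locally with probability tending to one (`IsParkingProcess.measureReal_gridConfig_ne_le`), and the
statements pass to the limit. -/

noncomputable section

/-! ### Deterministic discrete-time parking: walls, symmetries, blocking. -/

namespace TwoLineParking

/-- The configuration after one more car has arrived at site `i`; a configuration records the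
state of every site and the number of cars that arrived there. -/
def hit (i : ℤ) (c : ℤ → Fin 4 × ℕ) : ℤ → Fin 4 × ℕ :=
  Function.update c i (arrive (c (i - 1)).1 (c i).1 (c (i + 1)).1, (c i).2 + 1)

/-- Synchronous discrete-time parking: in step `j` every site `i` with `d (i, j) ≠ 0` receives
a car. -/
def grid (d : ℤ × ℕ → ℕ) : ℕ → ℤ → Fin 4
  | 0 => fun _ => 0
  | k + 1 => fun i => if d (i, k) = 0 then grid d k i
      else arrive (grid d k (i - 1)) (grid d k i) (grid d k (i + 1))

/-- The states of discrete-time parking together with the numbers of arrivals. -/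
def gridConfig (d : ℤ × ℕ → ℕ) (k : ℕ) (i : ℤ) : Fin 4 × ℕ :=
  (grid d k i, ∑ j ∈ Finset.range k, d (i, j))

/-- Remove the arrivals at the sites `i ≤ 0`. -/
def half (d : ℤ × ℕ → ℕ) (p : ℤ × ℕ) : ℕ := if 1 ≤ p.1 then d p else 0

theorem arrive_comm (l c r : Fin 4) : arrive l c r = arrive r c l := by
  revert l c r
  decide

theorem measurable_grid (k : ℕ) (i : ℤ) : Measurable fun d => grid d k i := by
  induction k generalizing i with
  | zero => exact measurable_const
  | succ k ih =>
    have harr : Measurable fun p : Fin 4 × Fin 4 × Fin 4 => arrive p.1 p.2.1 p.2.2 :=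
      measurable_of_countable _
    exact Measurable.ite (measurable_pi_apply (i, k) (measurableSet_singleton 0)) (ih i)
      (harr.comp ((ih (i - 1)).prodMk ((ih i).prodMk (ih (i + 1)))))

theorem measurable_gridConfig (k : ℕ) : Measurable fun d => gridConfig d k :=
  measurable_pi_lambda _ fun i => (measurable_grid k i).prodMk
    (Finset.measurable_sum _ fun j _ => measurable_pi_apply (i, j))

theorem measurable_half : Measurable half := by
  refine measurable_pi_lambda _ fun p => ?_
  unfold half
  split_ifs <;> fun_prop

theorem grid_congr {d d' : ℤ × ℕ → ℕ} {k : ℕ} (h : ∀ i, ∀ j < k, d (i, j) = d' (i, j)) :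
    grid d k = grid d' k := by
  induction k with
  | zero => rfl
  | succ k ih =>
    have := ih fun i j hj => h i j (hj.trans (Nat.lt_succ_self k))
    funext i
    simp only [grid, this, h i k (Nat.lt_succ_self k)]

theorem gridConfig_congr {d d' : ℤ × ℕ → ℕ} {k : ℕ} (h : ∀ i, ∀ j < k, d (i, j) = d' (i, j)) :
    gridConfig d k = gridConfig d' k := by
  funext i
  exact Prod.ext (congrFun (grid_congr h) i)
    (Finset.sum_congr rfl fun j hj => h i j (Finset.mem_range.1 hj))

theorem grid_eq_zero {d : ℤ × ℕ → ℕ} {k : ℕ} {i : ℤ} (h : ∀ j < k, d (i, j) = 0) :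
    grid d k i = 0 := by
  induction k with
  | zero => rfl
  | succ k ih =>
    simp only [grid, h k (Nat.lt_succ_self k), if_true]
    exact ih fun j hj => h j (hj.trans (Nat.lt_succ_self k))

/-- A site without arrivals stays vacant whatever happens to its left, so the sites to its right
cannot tell whether the cars on the left were removed. -/
theorem grid_half {d : ℤ × ℕ → ℕ} {k : ℕ} (h : ∀ j < k, d (0, j) = 0) (i : ℤ) (hi : 0 ≤ i) :
    grid (half d) k i = grid d k i := by
  induction k generalizing i with
  | zero => rfl
  | succ k ih =>
    have h' : ∀ j < k, d (0, j) = 0 := fun j hj => h j (hj.trans (Nat.lt_succ_self k))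
    rcases hi.eq_or_lt with rfl | hi
    · rw [grid_eq_zero h, grid_eq_zero fun j _ => by simp [half]]
    · have : (1 : ℤ) ≤ i := hi
      simp only [grid, half, this, if_true]
      rw [ih h' i (by omega), ih h' (i - 1) (by omega), ih h' (i + 1) (by omega)]

theorem gridConfig_half {d : ℤ × ℕ → ℕ} {k : ℕ} (h : ∀ j < k, d (0, j) = 0) (i : ℤ)
    (hi : 1 ≤ i) : gridConfig (half d) k i = gridConfig d k i := by
  refine Prod.ext (grid_half h i (by omega)) ?_
  simp [gridConfig, half, hi]

theorem gridConfig_translate (d : ℤ × ℕ → ℕ) (a : ℤ) (k : ℕ) (i : ℤ) :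
    gridConfig (fun p => d (a + p.1, p.2)) k i = gridConfig d k (a + i) := by
  refine Prod.ext ?_ rfl
  change grid _ k i = grid d k (a + i)
  induction k generalizing i with
  | zero => rfl
  | succ k ih => simp only [grid, ih, add_sub_assoc, add_assoc]

/-- The parking rule is symmetric in the two neighbours; this makes the left half-line a copy of the
right one. -/
theorem gridConfig_reflect (d : ℤ × ℕ → ℕ) (a : ℤ) (k : ℕ) (i : ℤ) :
    gridConfig (fun p => d (a - p.1, p.2)) k i = gridConfig d k (a - i) := by
  refine Prod.ext ?_ rfl
  change grid _ k i = grid d k (a - i)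
  induction k generalizing i with
  | zero => rfl
  | succ k ih =>
    simp only [grid, ih]
    rw [arrive_comm, show a - (i - 1) = a - i + 1 by ring, show a - (i + 1) = a - i - 1 by ring]

/-- A vacant site rejects cars exactly when a neighbour is in state `3` or the neighbours are in
states `1` and `2`. States `2` and `3` are final and `1` can only become `3`, so cars at the
neighbours do not undo the rejection. -/
theorem arrive_blocked (l r a b : Fin 4) (h : arrive l 0 r = 0) :
    arrive (arrive a l 0) 0 r = 0 ∧ arrive l 0 (arrive 0 r b) = 0 ∧
      arrive (arrive a l 0) 0 (arrive 0 r b) = 0 := by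
  revert l r a b
  decide

theorem arrive_ne_zero (l c r : Fin 4) (h : arrive l c r = 0) : c = 0 := by
  revert l c r
  decide

/-- A vacant site at which a car has arrived rejects all further cars. -/
theorem gridConfig_blocked (d : ℤ × ℕ → ℕ) (k : ℕ) (i : ℤ) (h : (gridConfig d k i).1 = 0)
    (hn : (gridConfig d k i).2 ≠ 0) :
    arrive (gridConfig d k (i - 1)).1 0 (gridConfig d k (i + 1)).1 = 0 := by
  simp only [gridConfig] at h hn ⊢
  induction k with
  | zero => simp at hn
  | succ k ih =>
    have h0 : grid d k i = 0 := by
      simp only [grid] at h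
      split_ifs at h
      · exact h
      · exact arrive_ne_zero _ _ _ h
    -- The site rejects cars already before step `k`: either by induction, or because the car of
    -- step `k` was itself rejected. The remaining cases are cars at the neighbours in that step.
    have key : arrive (grid d k (i - 1)) 0 (grid d k (i + 1)) = 0 := by
      by_cases hd : d (i, k) = 0
      · refine ih h0 ?_
        rwa [Finset.sum_range_succ, hd, add_zero] at hn
      · simpa only [grid, hd, if_false, h0] using h
    simp only [grid, sub_add_cancel, add_sub_cancel_right, h0]
    have := arrive_blocked _ _ (grid d k (i - 1 - 1)) (grid d k (i + 1 + 1)) key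
    split_ifs
    · exact key
    · exact this.2.1
    · exact this.1
    · exact this.2.2

/-- Between two sites without arrivals, a site is occupied in the first line only if and only if
exactly one car arrived there. -/
theorem gridConfig_isolated {d : ℤ × ℕ → ℕ} {k : ℕ} {i : ℤ} (hl : (gridConfig d k (i - 1)).2 = 0)
    (hr : (gridConfig d k (i + 1)).2 = 0) (hd : ∀ j < k, d (i, j) ≤ 1) :
    (gridConfig d k i).1 = 1 ↔ (gridConfig d k i).2 = 1 := by
  simp only [gridConfig] at hl hr ⊢
  -- Strengthened for the induction: with vacant neighbours the state runs through `0`, `1`, `3` as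
  -- the count passes `0`, `1`, and at least `2`. The bound `hd` matters because `grid` treats
  -- several arrivals in one step as a single car.
  suffices (∑ j ∈ Finset.range k, d (i, j) = 0 ∧ grid d k i = 0) ∨
      (∑ j ∈ Finset.range k, d (i, j) = 1 ∧ grid d k i = 1) ∨
      (2 ≤ ∑ j ∈ Finset.range k, d (i, j) ∧ grid d k i = 3) by
    rcases this with h | h | h
    · simp [h]
    · simp [h]
    · simp only [h.2, Fin.reduceEq, false_iff]
      omega
  induction k with
  | zero => simp [grid]
  | succ k ih =>
    have hl' := Finset.sum_eq_zero_iff.1 hl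
    have hr' := Finset.sum_eq_zero_iff.1 hr
    rw [Finset.sum_range_succ] at hl hr
    have hlg : grid d k (i - 1) = 0 := grid_eq_zero fun j hj => hl' j (by simp; omega)
    have hrg : grid d k (i + 1) = 0 := grid_eq_zero fun j hj => hr' j (by simp; omega)
    have h1 := hd k (Nat.lt_succ_self k)
    have ih' := ih (by omega) (by omega) fun j hj => hd j (hj.trans (Nat.lt_succ_self k))
    have e0 : arrive 0 0 0 = 1 := by decide
    have e1 : arrive 0 1 0 = 3 := by decide
    have e3 : arrive 0 3 0 = 3 := by decide
    simp only [grid, Finset.sum_range_succ, hlg, hrg]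
    obtain h | h : d (i, k) = 0 ∨ d (i, k) = 1 := by omega
    · simpa [h] using ih'
    · rcases ih' with h' | h' | h'
      · simp [h, h', e0]
      · simp [h, h', e1]
      · right; right
        simp only [h, h'.2, e3, one_ne_zero, if_false, and_true]
        omega

end TwoLineParking

end

/-! ### Independent increments and the exact factorization in discrete time. -/

noncomputable section

namespace TwoLineParking

section Independence

variable {Ω ι : Type*} [MeasurableSpace Ω] {P : Measure Ω} {X : ι → Ω → ℕ}

theorem indepFun_restrict (hX : iIndepFun X P) (hm : ∀ i, Measurable (X i)) {S T : Set ι}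
    (hST : Disjoint S T) : IndepFun (fun ω (i : S) => X i ω) (fun ω (i : T) => X i ω) P := by
  have key := indep_iSup_of_disjoint (fun i => (hm i).comap_le) hX hST
  have hle : ∀ U : Set ι, MeasurableSpace.comap (fun ω (i : U) => X i ω) inferInstance ≤
      ⨆ i ∈ U, MeasurableSpace.comap (X i) inferInstance := by
    intro U
    rw [MeasurableSpace.pi, MeasurableSpace.comap_iSup]
    refine iSup_le fun i => ?_
    rw [MeasurableSpace.comap_comp]
    exact le_iSup₂_of_le (f := fun i (_ : i ∈ U) => MeasurableSpace.comap (X i) inferInstance)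
      i.1 i.2 le_rfl
  exact indep_of_indep_of_le_right (indep_of_indep_of_le_left key (hle S)) (hle T)

/-- Events that depend on disjoint sets of coordinates of an independent family are
independent. -/
theorem measureReal_and_eq_mul (hX : iIndepFun X P) (hm : ∀ i, Measurable (X i)) {S T : Set ι}
    (hST : Disjoint S T) {A B : Set (ι → ℕ)} (hA : MeasurableSet A) (hB : MeasurableSet B)
    (hAS : ∀ d d' : ι → ℕ, (∀ i ∈ S, d i = d' i) → d ∈ A → d' ∈ A)
    (hBT : ∀ d d' : ι → ℕ, (∀ i ∈ T, d i = d' i) → d ∈ B → d' ∈ B) :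
    P.real {ω | (fun i => X i ω) ∈ A ∧ (fun i => X i ω) ∈ B} =
      P.real {ω | (fun i => X i ω) ∈ A} * P.real {ω | (fun i => X i ω) ∈ B} := by
  classical
  -- Filling the coordinates outside `U` with `0` is harmless for events that depend only on `U`,
  -- and writes them as preimages under the restriction to `U`.
  let ext (U : Set ι) (x : U → ℕ) (i : ι) : ℕ := if h : i ∈ U then x ⟨i, h⟩ else 0
  have hext : ∀ U, Measurable (ext U) := by
    refine fun U => measurable_pi_lambda _ fun i => ?_
    by_cases h : i ∈ U
    · simpa only [ext, h, dif_pos] using measurable_pi_apply _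
    · simp only [ext, h, dif_neg, not_false_eq_true, measurable_const]
  have hmem : ∀ (U : Set ι) (C : Set (ι → ℕ)),
      (∀ d d' : ι → ℕ, (∀ i ∈ U, d i = d' i) → d ∈ C → d' ∈ C) →
      {ω | (fun i => X i ω) ∈ C} = (fun ω (i : U) => X i ω) ⁻¹' (ext U ⁻¹' C) := by
    intro U C hC
    ext ω
    have : ∀ i ∈ U, X i ω = ext U (fun i => X i ω) i := fun i hi => by simp [ext, hi]
    exact ⟨hC _ _ this, hC _ _ fun i hi => (this i hi).symm⟩
  have := (indepFun_restrict hX hm hST).measure_inter_preimage_eq_mul _ _ (hext S hA) (hext T hB)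
  rw [← hmem S A hAS, ← hmem T B hBT] at this
  simp only [measureReal_def, ← ENNReal.toReal_mul, ← this]
  rfl

end Independence

variable {Ω : Type*} [MeasurableSpace Ω] {P : Measure Ω} {N : ℤ → ℝ≥0 → Ω → ℕ}
  {m : ℤ → ℝ≥0 → Ω → Fin 4} {τ : ℕ → ℝ≥0}

/-- The number of cars that arrive at the site `p.1` in the time interval
`(τ p.2, τ (p.2 + 1)]`. -/
def incr (N : ℤ → ℝ≥0 → Ω → ℕ) (τ : ℕ → ℝ≥0) (ω : Ω) (p : ℤ × ℕ) : ℕ :=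
  N p.1 (τ (p.2 + 1)) ω - N p.1 (τ p.2) ω

theorem IsParkingProcess.measurable_incr (h : IsParkingProcess P N m) (τ : ℕ → ℝ≥0) :
    Measurable (incr N τ) :=
  measurable_pi_lambda _ fun p => ((h.poisson p.1).measurable _).sub ((h.poisson p.1).measurable _)

theorem IsParkingProcess.iIndepFun_incr (h : IsParkingProcess P N m) (hτ : Monotone τ) :
    iIndepFun (fun p ω => incr N τ ω p) P := by
  refine iIndepFun_uncurry' (X := fun i j ω => incr N τ ω (i, j))
    (fun i j => (measurable_pi_apply (i, j)).comp (h.measurable_incr τ)) ?_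
    fun i => (h.poisson i).indepIncrements.nat hτ
  exact h.indep.comp (fun _ x j => x (τ (j + 1)) - x (τ j)) fun _ =>
    measurable_pi_lambda _ fun j => (measurable_pi_apply _).sub (measurable_pi_apply _)

theorem IsParkingProcess.hasLaw_incr (h : IsParkingProcess P N m) (hτ : Monotone τ) (p : ℤ × ℕ) :
    HasLaw (fun ω => incr N τ ω p) (poissonMeasure (τ (p.2 + 1) - τ p.2)) P :=
  (h.poisson p.1).increment_law _ _ (hτ (Nat.le_succ _))

/-- The joint law of the increments is invariant under relabelling of the sites. -/
theorem IsParkingProcess.measureReal_relabel (h : IsParkingProcess P N m) (hτ : Monotone τ)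
    {e : ℤ → ℤ} (he : e.Injective) {A : Set (ℤ × ℕ → ℕ)} (hA : MeasurableSet A) :
    P.real {ω | (fun p : ℤ × ℕ => incr N τ ω (e p.1, p.2)) ∈ A} =
      P.real {ω | incr N τ ω ∈ A} := by
  have hi := h.iIndepFun_incr hτ
  have := hi.isProbabilityMeasure
  -- The law of an increment depends on its time index only, so the original and the relabelled
  -- families have the same infinite product law.
  have h1 := hi.hasLaw_infinitePi (fun p => h.hasLaw_incr hτ p)
    (h.measurable_incr τ).aemeasurable
  have he' : Function.Injective fun p : ℤ × ℕ => (e p.1, p.2) := by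
    rintro ⟨a, b⟩ ⟨c, d⟩ hh
    simp only [Prod.mk.injEq] at hh ⊢
    exact ⟨he hh.1, hh.2⟩
  have h2 := (hi.precomp he').hasLaw_infinitePi (fun p : ℤ × ℕ => h.hasLaw_incr hτ (e p.1, p.2))
    (measurable_pi_lambda _ fun p =>
      (measurable_pi_apply _).comp (h.measurable_incr τ)).aemeasurable
  exact (h2.measureReal_eq (p := (· ∈ A)) hA).trans (h1.measureReal_eq (p := (· ∈ A)) hA).symm

theorem IsParkingProcess.ae_sum_incr (h : IsParkingProcess P N m) (hτ : Monotone τ)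
    (h0 : τ 0 = 0) : ∀ᵐ ω ∂P, ∀ i k, ∑ j ∈ Finset.range k, incr N τ ω (i, j) = N i (τ k) ω := by
  have hz : ∀ᵐ ω ∂P, ∀ i, N i 0 ω = 0 := ae_all_iff.2 fun i => (h.poisson i).zero
  have hmono : ∀ᵐ ω ∂P, ∀ i, Monotone fun t => N i t ω :=
    ae_all_iff.2 fun i => (h.poisson i).monotone
  filter_upwards [hz, hmono] with ω hz hmono i k
  induction k with
  | zero => simp [h0, hz]
  | succ k ih =>
    rw [Finset.sum_range_succ, ih]
    exact Nat.add_sub_cancel' (hmono i (hτ (Nat.le_succ k)))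

theorem IsParkingProcess.hasLaw (h : IsParkingProcess P N m) (i : ℤ) (t : ℝ≥0) :
    HasLaw (N i t) (poissonMeasure t) P := by
  have := (h.poisson i).increment_law 0 t zero_le
  rw [tsub_zero] at this
  refine this.congr ?_
  filter_upwards [(h.poisson i).zero] with ω hω
  simp [hω]

theorem IsParkingProcess.measureReal_eq_zero (h : IsParkingProcess P N m) (i : ℤ) (t : ℝ≥0) :
    P.real {ω | N i t ω = 0} = Real.exp (-t) := by
  rw [(h.hasLaw i t).measureReal_eq (p := (· = 0)) .of_discrete]
  simpa using poissonMeasure_real_singleton t 0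

/-- The configurations to the left and to the right of a site without arrivals are independent
copies of each other. -/
theorem IsParkingProcess.measureReal_gridConfig_split (h : IsParkingProcess P N m)
    (hτ : Monotone τ) (h0 : τ 0 = 0) (a : ℤ) (k : ℕ)
    (S' S : Set ((Fin 4 × ℕ) × (Fin 4 × ℕ))) :
    P.real {ω | (gridConfig (incr N τ ω) k a).2 = 0 ∧
        (gridConfig (incr N τ ω) k (a - 1), gridConfig (incr N τ ω) k (a - 2)) ∈ S' ∧
        (gridConfig (incr N τ ω) k (a + 1), gridConfig (incr N τ ω) k (a + 2)) ∈ S} =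
      Real.exp (-(τ k)) *
        (P.real {ω | (gridConfig (half (incr N τ ω)) k 1,
            gridConfig (half (incr N τ ω)) k 2) ∈ S'} *
        P.real {ω | (gridConfig (half (incr N τ ω)) k 1,
          gridConfig (half (incr N τ ω)) k 2) ∈ S}) := by
  have hi := h.iIndepFun_incr hτ
  have := hi.isProbabilityMeasure
  have hm : ∀ p, Measurable fun ω => incr N τ ω p := fun p =>
    (measurable_pi_apply p).comp (h.measurable_incr τ)
  let H (U : Set ((Fin 4 × ℕ) × (Fin 4 × ℕ))) : Set (ℤ × ℕ → ℕ) :=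
    {d | (gridConfig (half d) k 1, gridConfig (half d) k 2) ∈ U}
  have hH : ∀ U, MeasurableSet (H U) := fun U =>
    ((((measurable_pi_apply 1).comp (measurable_gridConfig k)).comp measurable_half).prodMk
      (((measurable_pi_apply 2).comp (measurable_gridConfig k)).comp measurable_half)) .of_discrete
  let A : Set (ℤ × ℕ → ℕ) := {d | (fun p : ℤ × ℕ => d (a + p.1, p.2)) ∈ H S}
  let A' : Set (ℤ × ℕ → ℕ) := {d | (fun p : ℤ × ℕ => d (a - p.1, p.2)) ∈ H S'}
  let B : Set (ℤ × ℕ → ℕ) := {d | (gridConfig d k a).2 = 0}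
  have hA : MeasurableSet A :=
    (measurable_pi_lambda _ fun p => measurable_pi_apply (a + p.1, p.2)) (hH S)
  have hA' : MeasurableSet A' :=
    (measurable_pi_lambda _ fun p => measurable_pi_apply (a - p.1, p.2)) (hH S')
  have hB : MeasurableSet B :=
    (measurable_snd.comp ((measurable_pi_apply a).comp (measurable_gridConfig k)))
      (measurableSet_singleton 0)
  have hAS : ∀ d d' : ℤ × ℕ → ℕ, (∀ p ∈ {p : ℤ × ℕ | a < p.1}, d p = d' p) → d ∈ A → d' ∈ A := by
    intro d d' hd hdA
    have : half (fun p : ℤ × ℕ => d (a + p.1, p.2)) = half fun p => d' (a + p.1, p.2) := by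
      funext p
      unfold half
      split_ifs with hp
      · exact hd _ (by simp; omega)
      · rfl
    simpa only [A, H, Set.mem_ofPred_eq, this] using hdA
  have hAS' : ∀ d d' : ℤ × ℕ → ℕ, (∀ p ∈ {p : ℤ × ℕ | p.1 < a}, d p = d' p) →
      d ∈ A' → d' ∈ A' := by
    intro d d' hd hdA
    have : half (fun p : ℤ × ℕ => d (a - p.1, p.2)) = half fun p => d' (a - p.1, p.2) := by
      funext p
      unfold half
      split_ifs with hp
      · exact hd _ (by simp; omega)
      · rfl
    simpa only [A', H, Set.mem_ofPred_eq, this] using hdA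
  have hBS : ∀ d d' : ℤ × ℕ → ℕ, (∀ p ∈ {p : ℤ × ℕ | p.1 = a}, d p = d' p) → d ∈ B → d' ∈ B := by
    intro d d' hd hdB
    simpa [B, gridConfig, hd] using hdB
  -- On `B` the site `a` is a wall: each side is unchanged when the cars at `a` and beyond are
  -- deleted, so it becomes a function of its own increments alone.
  have hset : ∀ d : ℤ × ℕ → ℕ, ((gridConfig d k a).2 = 0 ∧
      (gridConfig d k (a - 1), gridConfig d k (a - 2)) ∈ S' ∧
      (gridConfig d k (a + 1), gridConfig d k (a + 2)) ∈ S) ↔ d ∈ B ∧ d ∈ A' ∩ A := by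
    intro d
    refine and_congr_right fun hb => ?_
    have hb' : ∀ j < k, d (a, j) = 0 := fun j hj =>
      Finset.sum_eq_zero_iff.1 (show ∑ j ∈ Finset.range k, d (a, j) =
          0 from hb) j (Finset.mem_range.2 hj)
    have e1 : ∀ i, 1 ≤ i → gridConfig (half fun p => d (a + p.1, p.2)) k i =
        gridConfig d k (a + i) := fun i hi => by
      rw [gridConfig_half (by simpa using hb') i hi, gridConfig_translate]
    have e2 : ∀ i, 1 ≤ i → gridConfig (half fun p => d (a - p.1, p.2)) k i =
        gridConfig d k (a - i) := fun i hi => by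
      rw [gridConfig_half (by simpa using hb') i hi, gridConfig_reflect]
    simp only [A, A', H, Set.mem_inter_iff, Set.mem_ofPred_eq, e1 1 le_rfl, e1 2 one_le_two,
      e2 1 le_rfl, e2 2 one_le_two]
  simp only [hset]
  have hd1 : Disjoint {p : ℤ × ℕ | p.1 = a} ({p | p.1 < a} ∪ {p | a < p.1}) := by
    rw [Set.disjoint_left]
    rintro p hp (hq | hq) <;> simp only [Set.mem_ofPred_eq] at hp hq <;> omega
  have hd2 : Disjoint {p : ℤ × ℕ | p.1 < a} {p | a < p.1} := by
    rw [Set.disjoint_left]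
    intro p hp hq
    simp only [Set.mem_ofPred_eq] at hp hq
    omega
  have i1 := measureReal_and_eq_mul hi hm hd1 hB (hA'.inter hA) hBS fun d d' hd hdA =>
    ⟨hAS' d d' (fun p hp => hd p (Or.inl hp)) hdA.1, hAS d d' (fun p hp => hd p (Or.inr hp)) hdA.2⟩
  have i2 := measureReal_and_eq_mul hi hm hd2 hA' hA hAS' hAS
  have r1 := h.measureReal_relabel hτ (add_right_injective a) (hH S)
  have r2 := h.measureReal_relabel hτ (e := fun i => a - i) sub_right_injective (hH S')
  have hBP : P.real {ω | incr N τ ω ∈ B} = Real.exp (-(τ k)) := by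
    rw [← h.measureReal_eq_zero a]
    refine measureReal_congr ?_
    filter_upwards [h.ae_sum_incr hτ h0] with ω hω
    change (_ = 0) = (_ = 0)
    rw [← hω]
    rfl
  refine i1.trans ?_
  rw [← hBP]
  congr 1
  exact i2.trans (congrArg₂ (· * ·) r2 r1)

/-- The increments over a later time interval are independent of discrete-time parking. -/
theorem IsParkingProcess.measureReal_gridConfig_and (h : IsParkingProcess P N m)
    (hτ : Monotone τ) (k : ℕ) {E : Set (ℤ → Fin 4 × ℕ)} (hE : MeasurableSet E)
    {F : Set (ℤ → ℕ)} (hF : MeasurableSet F) :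
    P.real {ω | gridConfig (incr N τ ω) k ∈ E ∧ (fun i => incr N τ ω (i, k)) ∈ F} =
      P.real {ω | gridConfig (incr N τ ω) k ∈ E} *
        P.real {ω | (fun i => incr N τ ω (i, k)) ∈ F} := by
  have hd : Disjoint {p : ℤ × ℕ | p.2 < k} {p | p.2 = k} := by
    rw [Set.disjoint_left]
    intro p hp hq
    simp only [Set.mem_ofPred_eq] at hp hq
    omega
  refine measureReal_and_eq_mul (h.iIndepFun_incr hτ)
    (fun p => (measurable_pi_apply p).comp (h.measurable_incr τ)) hd
    (A := {d | gridConfig d k ∈ E}) (B := {d | (fun i => d (i, k)) ∈ F})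
    (measurable_gridConfig k hE)
    ((measurable_pi_lambda _ fun i => measurable_pi_apply (i, k)) hF) ?_ ?_
  · intro d d' hd hdE
    have := gridConfig_congr (k := k) fun i j hj => hd (i, j) hj
    rwa [Set.mem_ofPred_eq, ← this]
  · intro d d' hd hdF
    have : (fun i => d (i, k)) = fun i => d' (i, k) := funext fun i => hd (i, k) rfl
    rwa [Set.mem_ofPred_eq, ← this]

end TwoLineParking

end

/-! ### Approximation of the process by discrete time, and passage to the limit. -/

noncomputable section

namespace TwoLineParking

open Filter Topology

variable {Ω : Type*} [MeasurableSpace Ω] {P : Measure Ω} {N : ℤ → ℝ≥0 → Ω → ℕ}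
  {m : ℤ → ℝ≥0 → Ω → Fin 4}

/-- The subdivision of `[0, t]` into `k` intervals of equal length, followed by `t + s`. -/
def mesh (t s : ℝ≥0) (k j : ℕ) : ℝ≥0 := if j ≤ k then t * j / k else t + s

theorem mesh_zero (t s : ℝ≥0) (k : ℕ) : mesh t s k 0 = 0 := by simp [mesh]

theorem mesh_self (t s : ℝ≥0) {k : ℕ} (hk : k ≠ 0) : mesh t s k k = t := by
  have : (k : ℝ≥0) ≠ 0 := by exact_mod_cast hk
  simp [mesh, this]

theorem mesh_succ_self (t s : ℝ≥0) (k : ℕ) : mesh t s k (k + 1) = t + s := by simp [mesh]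

theorem mesh_sub (t s : ℝ≥0) {k j : ℕ} (hj : j < k) :
    mesh t s k (j + 1) - mesh t s k j = t / k := by
  have h1 : j + 1 ≤ k := hj
  rw [mesh, mesh, if_pos h1, if_pos hj.le]
  push_cast
  rw [mul_add, add_div, add_tsub_cancel_left, mul_one]

theorem mesh_monotone (t s : ℝ≥0) {k : ℕ} (hk : k ≠ 0) : Monotone (mesh t s k) := by
  intro i j hij
  have hk' : (0 : ℝ≥0) < k := by exact_mod_cast Nat.pos_of_ne_zero hk
  unfold mesh
  split_ifs with h1 h2 h2
  · gcongr
  · rw [div_le_iff₀ hk', add_mul]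
    refine le_add_right ?_
    gcongr
  · omega
  · rfl

/-- The sites `a` and `b` receive no car and stay vacant in both models. Between them each step
brings at most one car in all, so the synchronous update is exactly the one prescribed by
`noArrival` and `oneArrival`. -/
theorem grid_eq_of_isParkingPath {n : ℤ → ℝ≥0 → ℕ} {x : ℤ → ℝ≥0 → Fin 4}
    (hx : IsParkingPath n x) (hn : ∀ i, Monotone (n i)) {τ : ℕ → ℝ≥0} (hτ : Monotone τ)
    (h0 : τ 0 = 0) {a b : ℤ} {k : ℕ} (ha : n a (τ k) = n a 0) (hb : n b (τ k) = n b 0)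
    (h1 : ∀ j < k, ∀ u, a ≤ u → u ≤ b → n u (τ (j + 1)) - n u (τ j) ≤ 1)
    (h2 : ∀ j < k, ∀ u, a ≤ u → u ≤ b → ∀ v, a ≤ v → v ≤ b → n u (τ (j + 1)) - n u (τ j) ≠ 0 →
      n v (τ (j + 1)) - n v (τ j) ≠ 0 → u = v) :
    ∀ j ≤ k, ∀ u, a ≤ u → u ≤ b →
      grid (fun p => n p.1 (τ (p.2 + 1)) - n p.1 (τ p.2)) j u = x u (τ j) := by
  have hedge : ∀ c, n c (τ k) = n c 0 → ∀ j ≤ k,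
      grid (fun p => n p.1 (τ (p.2 + 1)) - n p.1 (τ p.2)) j c = x c (τ j) := by
    intro c hc j hj
    have hconst : ∀ i ≤ k, n c (τ i) = n c 0 := fun i hi =>
      le_antisymm ((hn c (hτ hi)).trans hc.le) (hn c zero_le)
    rw [hx.noArrival c 0 (τ j) zero_le (hconst j hj), hx.start]
    refine grid_eq_zero fun i hi => ?_
    simp [hconst i (by omega), hconst (i + 1) (by omega)]
  intro j
  induction j with
  | zero =>
    intro _ u _ _
    rw [h0, hx.start]
    rfl
  | succ j ih =>
    intro hj u hau hub
    rcases hau.eq_or_lt with rfl | hau'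
    · exact hedge _ ha _ hj
    rcases hub.eq_or_lt with rfl | hub'
    · exact hedge _ hb _ hj
    have ih' := ih (by omega)
    have hle : τ j ≤ τ (j + 1) := hτ (Nat.le_succ j)
    simp only [grid]
    have := hn u hle
    split_ifs with hd
    · rw [ih' u hau hub]
      exact (hx.noArrival u _ _ hle (by omega)).symm
    · rw [ih' u hau hub, ih' (u - 1) (by omega) (by omega), ih' (u + 1) (by omega) (by omega)]
      have hother : ∀ v, a ≤ v → v ≤ b → u ≠ v → n v (τ (j + 1)) = n v (τ j) := by
        intro v hav hvb huv
        have := hn v hle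
        by_contra hne
        exact huv (h2 j (by omega) u hau hub v hav hvb hd (by omega))
      have := h1 j (by omega) u hau hub
      exact (hx.oneArrival u _ _ hle (by omega) (hother _ (by omega) (by omega) (by omega))
        (hother _ (by omega) (by omega) (by omega))).symm

theorem poissonMeasure_real_ne_zero_le (r : ℝ≥0) : (poissonMeasure r).real {n | n ≠ 0} ≤ r := by
  have h0 : (poissonMeasure r).real {0} = Real.exp (-r) := by
    simpa using poissonMeasure_real_singleton r 0
  have : {n : ℕ | n ≠ 0} = {0}ᶜ := rfl
  rw [this, probReal_compl_eq_one_sub .of_discrete, h0]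
  linarith [Real.one_sub_le_exp_neg (r : ℝ)]

theorem poissonMeasure_real_two_le_le (r : ℝ≥0) :
    (poissonMeasure r).real {n | 2 ≤ n} ≤ r ^ 2 := by
  have h0 : (poissonMeasure r).real {0} = Real.exp (-r) := by
    simpa using poissonMeasure_real_singleton r 0
  have h1 : (poissonMeasure r).real {1} = Real.exp (-r) * r := by
    simpa using poissonMeasure_real_singleton r 1
  have : {n : ℕ | 2 ≤ n} = ({0} ∪ {1})ᶜ := by
    ext n
    simp only [Set.mem_ofPred_eq, Set.mem_compl_iff, Set.mem_union, Set.mem_singleton_iff]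
    omega
  rw [this, probReal_compl_eq_one_sub .of_discrete,
    measureReal_union (by simp) .of_discrete, h0, h1]
  -- The bound is `1 - exp (-r) * (1 + r) ≤ 1 - (1 - r) * (1 + r) = r ^ 2`.
  nlinarith [Real.one_sub_le_exp_neg (r : ℝ), r.coe_nonneg]

theorem IsParkingProcess.measureReal_two_le_incr (h : IsParkingProcess P N m) {τ : ℕ → ℝ≥0}
    (hτ : Monotone τ) (p : ℤ × ℕ) :
    P.real {ω | 2 ≤ incr N τ ω p} ≤ ((τ (p.2 + 1) - τ p.2 : ℝ≥0) : ℝ) ^ 2 := by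
  rw [(h.hasLaw_incr hτ p).measureReal_eq (p := (2 ≤ ·)) .of_discrete]
  exact poissonMeasure_real_two_le_le _

theorem IsParkingProcess.measureReal_two_incr (h : IsParkingProcess P N m) {τ : ℕ → ℝ≥0}
    (hτ : Monotone τ) {u v : ℤ} (huv : u ≠ v) (j : ℕ) :
    P.real {ω | incr N τ ω (u, j) ≠ 0 ∧ incr N τ ω (v, j) ≠ 0} ≤
      ((τ (j + 1) - τ j : ℝ≥0) : ℝ) ^ 2 := by
  have hne : ((u, j) : ℤ × ℕ) ≠ (v, j) := fun hh => huv (Prod.ext_iff.1 hh).1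
  have hi := ((h.iIndepFun_incr hτ).indepFun hne).measure_inter_preimage_eq_mul {n | n ≠ 0}
    {n | n ≠ 0} .of_discrete .of_discrete
  have hle : ∀ w, P.real {ω | incr N τ ω (w, j) ≠ 0} ≤ ((τ (j + 1) - τ j : ℝ≥0) : ℝ) := fun w => by
    rw [(h.hasLaw_incr hτ (w, j)).measureReal_eq (p := (· ≠ 0)) .of_discrete]
    exact poissonMeasure_real_ne_zero_le _
  have : P.real {ω | incr N τ ω (u, j) ≠ 0 ∧ incr N τ ω (v, j) ≠ 0} =
      P.real {ω | incr N τ ω (u, j) ≠ 0} * P.real {ω | incr N τ ω (v, j) ≠ 0} := by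
    simp only [measureReal_def, ← ENNReal.toReal_mul]
    exact congrArg ENNReal.toReal hi
  rw [this, sq]
  exact mul_le_mul (hle u) (hle v) measureReal_nonneg NNReal.zero_le_coe

theorem IsParkingProcess.measureReal_forall_ne_zero (h : IsParkingProcess P N m) (t : ℝ≥0)
    {e : ℕ → ℤ} (he : e.Injective) (L : ℕ) :
    P.real {ω | ∀ l < L, N (e l) t ω ≠ 0} = (1 - Real.exp (-t)) ^ L := by
  have hi := ((h.indep.comp (fun _ x => x t) fun _ => measurable_pi_apply t).precomp he)
  have := hi.isProbabilityMeasure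
  have key := hi.measure_inter_preimage_eq_mul (Finset.range L) (sets := fun _ => {n : ℕ | n ≠ 0})
    fun _ _ => .of_discrete
  have hset : {ω | ∀ l < L, N (e l) t ω ≠ 0} = ⋂ l ∈ Finset.range L,
      ((fun x : ℝ≥0 → ℕ => x t) ∘ fun ω => fun t => N (e l) t ω) ⁻¹' {n : ℕ | n ≠ 0} := by
    ext ω
    simp
  rw [measureReal_def, hset, key, ENNReal.toReal_prod, Finset.prod_eq_pow_card (b :=
      1 - Real.exp (-t)),
    Finset.card_range]
  intro l _
  rw [← h.measureReal_eq_zero (e l) t, ← probReal_compl_eq_one_sub]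
  · rfl
  · exact ((h.poisson (e l)).measurable t) (measurableSet_singleton 0)

/-- The states of the sites and the numbers of arrivals at time `t`. -/
def config (N : ℤ → ℝ≥0 → Ω → ℕ) (m : ℤ → ℝ≥0 → Ω → Fin 4) (t : ℝ≥0) (ω : Ω) (i : ℤ) :
    Fin 4 × ℕ :=
  (m i t ω, N i t ω)

theorem IsParkingProcess.measurable_config (h : IsParkingProcess P N m) (t : ℝ≥0) :
    Measurable (config N m t) :=
  measurable_pi_lambda _ fun i => (h.measurable i t).prodMk ((h.poisson i).measurable t)

theorem IsParkingProcess.isProbabilityMeasure (h : IsParkingProcess P N m) :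
    IsProbabilityMeasure P :=
  h.indep.isProbabilityMeasure

/-- Disagreement at `i` requires a bad event: no wall among the `L` sites on one side, two cars at
one site in a single step, or cars at two sites in a single step, within a window of `2 * L + 1`
sites. Each multiple-arrival event has probability at most `(t / k) ^ 2`, and summing over `k` steps
leaves a factor `t ^ 2 / k`. -/
theorem IsParkingProcess.measureReal_gridConfig_ne_le (h : IsParkingProcess P N m) (t s : ℝ≥0)
    (i : ℤ) (L : ℕ) {k : ℕ} (hk : k ≠ 0) :
    P.real {ω | gridConfig (incr N (mesh t s k) ω) k i ≠ config N m t ω i} ≤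
      2 * (1 - Real.exp (-t)) ^ L + 2 * (2 * L + 1) ^ 2 * (t ^ 2 / k) := by
  have := h.isProbabilityMeasure
  have hτ := mesh_monotone t s hk
  have h0 := mesh_zero t s k
  have htk := mesh_self t s hk
  set τ := mesh t s k with hτdef
  let W := Finset.Icc (i - L) (i + L)
  have hW : (W.card : ℝ) = 2 * L + 1 := by
    have : W.card = 2 * L + 1 := by
      simp only [W, Int.card_Icc]
      omega
    rw [this]
    push_cast
    ring
  let BL : Set Ω := {ω | ∀ l < L, N (i - 1 - l) t ω ≠ 0}
  let BR : Set Ω := {ω | ∀ l < L, N (i + 1 + l) t ω ≠ 0}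
  let B1 : Set Ω := ⋃ q ∈ W ×ˢ Finset.range k, {ω | 2 ≤ incr N τ ω q}
  let B2 : Set Ω := ⋃ q ∈ (W.offDiag) ×ˢ Finset.range k,
    {ω | incr N τ ω (q.1.1, q.2) ≠ 0 ∧ incr N τ ω (q.1.2, q.2) ≠ 0}
  have hBL : P.real BL = (1 - Real.exp (-t)) ^ L :=
    h.measureReal_forall_ne_zero t (e := fun l => i - 1 - l) (fun a b hab => by simpa using hab) L
  have hBR : P.real BR = (1 - Real.exp (-t)) ^ L :=
    h.measureReal_forall_ne_zero t (e := fun l => i + 1 + l) (fun a b hab => by simpa using hab) L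
  have hδ : ∀ j < k, ((τ (j + 1) - τ j : ℝ≥0) : ℝ) ^ 2 = t ^ 2 / k ^ 2 := fun j hj => by
    rw [hτdef, mesh_sub t s hj]
    push_cast
    rw [div_pow]
  have hk' : (k : ℝ) ≠ 0 := by exact_mod_cast hk
  have hB1 : P.real B1 ≤ (2 * L + 1) ^ 2 * (t ^ 2 / k) := by
    refine (measureReal_biUnion_finset_le _ _).trans ?_
    refine (Finset.sum_le_card_nsmul _ _ (t ^ 2 / k ^ 2 : ℝ) fun q hq => ?_).trans ?_
    · rw [← hδ q.2 (Finset.mem_range.1 (Finset.mem_product.1 hq).2)]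
      exact h.measureReal_two_le_incr hτ q
    · rw [Finset.card_product, Finset.card_range, nsmul_eq_mul]
      push_cast
      rw [hW]
      have : (2 * L + 1 : ℝ) * k * (t ^ 2 / k ^ 2) = (2 * L + 1) * (t ^ 2 / k) := by field_simp
      rw [this]
      gcongr
      nlinarith [(Nat.cast_nonneg L : (0 : ℝ) ≤ L)]
  have hB2 : P.real B2 ≤ (2 * L + 1) ^ 2 * (t ^ 2 / k) := by
    refine (measureReal_biUnion_finset_le _ _).trans ?_
    refine (Finset.sum_le_card_nsmul _ _ (t ^ 2 / k ^ 2 : ℝ) fun q hq => ?_).trans ?_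
    · have hq' := Finset.mem_product.1 hq
      rw [← hδ q.2 (Finset.mem_range.1 hq'.2)]
      exact h.measureReal_two_incr hτ (Finset.mem_offDiag.1 hq'.1).2.2 q.2
    · rw [Finset.card_product, Finset.card_range, nsmul_eq_mul]
      have hcard : (W.offDiag.card : ℝ) ≤ (2 * L + 1) ^ 2 := by
        rw [← hW, sq]
        exact_mod_cast Finset.offDiag_card W ▸ Nat.sub_le _ _
      push_cast
      have : (W.offDiag.card : ℝ) * k * (t ^ 2 / k ^ 2) = W.offDiag.card * (t ^ 2 / k) := by
        field_simp
      rw [this]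
      gcongr
  have hsub : ∀ᵐ ω ∂P, gridConfig (incr N τ ω) k i ≠ config N m t ω i →
      ω ∈ BL ∪ BR ∪ B1 ∪ B2 := by
    have hz : ∀ᵐ ω ∂P, ∀ i, N i 0 ω = 0 := ae_all_iff.2 fun i => (h.poisson i).zero
    have hmono : ∀ᵐ ω ∂P, ∀ i, Monotone fun t => N i t ω :=
      ae_all_iff.2 fun i => (h.poisson i).monotone
    filter_upwards [h.ae_sum_incr hτ h0, hz, hmono, h.path] with ω hsum hz hmono hpath hne
    by_contra hbad
    simp only [Set.mem_union, not_or] at hbad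
    obtain ⟨⟨⟨hl, hr⟩, hb1⟩, hb2⟩ := hbad
    simp only [BL, BR, Set.mem_ofPred_eq, not_forall, not_not] at hl hr
    obtain ⟨l, hlL, hl⟩ := hl
    obtain ⟨r, hrL, hr⟩ := hr
    simp only [B1, B2, Set.mem_iUnion, not_exists, Finset.mem_product, Set.mem_ofPred_eq,
      Finset.mem_range, Finset.mem_offDiag, W, Finset.mem_Icc] at hb1 hb2
    refine hne (Prod.ext ?_ ((hsum i k).trans (by rw [htk]; rfl)))
    have key := grid_eq_of_isParkingPath hpath hmono hτ h0 (k := k) (a := i - 1 - l)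
      (b := i + 1 + r) (by rw [htk, hl, hz]) (by rw [htk, hr, hz])
      (fun j hj u hu hu' => by
        have := hb1 (u, j) ⟨⟨by omega, by omega⟩, hj⟩
        unfold incr at this
        simp only at this
        omega)
      (fun j hj u hu hu' v hv hv' hdu hdv => by
        by_contra huv
        have hu2 : i - L ≤ u ∧ u ≤ i + L := ⟨by omega, by omega⟩
        have hv2 : i - L ≤ v ∧ v ≤ i + L := ⟨by omega, by omega⟩
        exact hb2 ((u, v), j) ⟨⟨hu2, hv2, huv⟩, hj⟩ ⟨hdu, hdv⟩)
      k le_rfl i (by omega) (by omega)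
    rw [htk] at key
    exact key
  calc P.real {ω | gridConfig (incr N τ ω) k i ≠ config N m t ω i}
      ≤ P.real (BL ∪ BR ∪ B1 ∪ B2) := by
        rw [measureReal_def, measureReal_def]
        exact ENNReal.toReal_mono (measure_ne_top _ _) (measure_mono_ae hsub)
    _ ≤ P.real BL + P.real BR + P.real B1 + P.real B2 :=
        (measureReal_union_le _ _).trans (add_le_add_left ((measureReal_union_le _ _).trans
          (add_le_add_left (measureReal_union_le _ _) _)) _)
    _ ≤ _ := by
        rw [hBL, hBR]
        linarith

theorem tendsto_div_cube (C : ℝ) :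
    Tendsto (fun n : ℕ => (2 * (n : ℝ) + 1) ^ 2 * (C / ((n + 1) ^ 3 : ℕ))) atTop (𝓝 0) := by
  have h1 : Tendsto (fun n : ℕ => 4 * |C| * (1 / ((n : ℝ) + 1))) atTop (𝓝 0) := by
    simpa using tendsto_one_div_add_atTop_nhds_zero_nat.const_mul (4 * |C|)
  refine squeeze_zero_norm (fun n => ?_) h1
  have hn : (0 : ℝ) ≤ n := Nat.cast_nonneg n
  rw [Real.norm_eq_abs, abs_mul, abs_div, abs_of_nonneg (by positivity : (0 : ℝ) ≤ (2 * n + 1) ^ 2)]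
  push_cast
  rw [abs_of_nonneg (by positivity : (0 : ℝ) ≤ ((n : ℝ) + 1) ^ 3)]
  have : 4 * |C| * (1 / ((n : ℝ) + 1)) = (2 * (n + 1)) ^ 2 * (|C| / (n + 1) ^ 3) := by
    field_simp
    ring
  rw [this]
  gcongr
  linarith

/-- The window radius is `L = n` and there are `(n + 1) ^ 3` steps: the window grows, so walls are
eventually found, but its squared size is of smaller order than the number of steps. -/
theorem IsParkingProcess.tendsto_gridConfig_ne (h : IsParkingProcess P N m) (t s : ℝ≥0) (i : ℤ) :
    Tendsto (fun n : ℕ => P.real {ω | gridConfig (incr N (mesh t s ((n + 1) ^ 3)) ω)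
      ((n + 1) ^ 3) i ≠ config N m t ω i}) atTop (𝓝 0) := by
  have hlim : Tendsto (fun n : ℕ => 2 * (1 - Real.exp (-t)) ^ n +
      2 * ((2 * (n : ℝ) + 1) ^ 2 * ((t : ℝ) ^ 2 / ((n + 1) ^ 3 : ℕ)))) atTop (𝓝 0) := by
    have h1 : Tendsto (fun n : ℕ => (1 - Real.exp (-t)) ^ n) atTop (𝓝 0) :=
      tendsto_pow_atTop_nhds_zero_of_lt_one
        (by linarith [Real.exp_le_one_iff.2 (neg_nonpos.2 t.coe_nonneg)])
        (by linarith [Real.exp_pos (-(t : ℝ))])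
    simpa using (h1.const_mul 2).add ((tendsto_div_cube ((t : ℝ) ^ 2)).const_mul 2)
  refine squeeze_zero (fun _ => measureReal_nonneg) (fun n => ?_) hlim
  have := h.measureReal_gridConfig_ne_le t s i n (k := (n + 1) ^ 3) (by positivity)
  rwa [mul_assoc 2] at this

/-- Membership in `A` depends only on the sites in `W`. -/
def IsLocal (W : Finset ℤ) (A : Set (ℤ → Fin 4 × ℕ)) : Prop :=
  ∀ c c', (∀ i ∈ W, c i = c' i) → c ∈ A → c' ∈ A

/-- A local event is a cylinder over a countable discrete space. -/
theorem IsLocal.measurableSet {W : Finset ℤ} {A : Set (ℤ → Fin 4 × ℕ)} (hA : IsLocal W A) :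
    MeasurableSet A := by
  have : A = W.restrict ⁻¹' (W.restrict '' A) := by
    refine (Set.subset_preimage_image _ _).antisymm ?_
    rintro c ⟨c', hc', hcc⟩
    exact hA c' c (fun i hi => congrFun hcc ⟨i, hi⟩) hc'
  rw [this]
  exact (Finset.measurable_restrict W) (Set.to_countable _).measurableSet

/-- Probabilities of local events of discrete-time parking converge. -/
theorem IsParkingProcess.tendsto_gridConfig (h : IsParkingProcess P N m) (t s : ℝ≥0)
    {W : Finset ℤ} {A : Set (ℤ → Fin 4 × ℕ)} (hA : IsLocal W A) {B : Set Ω}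
    (hB : MeasurableSet B) :
    Tendsto (fun n : ℕ => P.real {ω | gridConfig (incr N (mesh t s ((n + 1) ^ 3)) ω)
      ((n + 1) ^ 3) ∈ A ∧ ω ∈ B}) atTop (𝓝 (P.real {ω | config N m t ω ∈ A ∧ ω ∈ B})) := by
  have := h.isProbabilityMeasure
  have hsum := tendsto_finsetSum W fun i _ => h.tendsto_gridConfig_ne t s i
  rw [Finset.sum_const_zero] at hsum
  refine tendsto_iff_dist_tendsto_zero.2 (squeeze_zero (fun _ => dist_nonneg) (fun n => ?_) hsum)
  have m1 : MeasurableSet {ω | gridConfig (incr N (mesh t s ((n + 1) ^ 3)) ω)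
      ((n + 1) ^ 3) ∈ A ∧ ω ∈ B} :=
    (((measurable_gridConfig _).comp (h.measurable_incr _)) hA.measurableSet).inter hB
  have m2 : MeasurableSet {ω | config N m t ω ∈ A ∧ ω ∈ B} :=
    ((h.measurable_config t) hA.measurableSet).inter hB
  refine (abs_measureReal_sub_le_measureReal_symmDiff m1.nullMeasurableSet
    m2.nullMeasurableSet).trans ?_
  refine le_trans (measureReal_mono ?_ (measure_ne_top _ _)) (measureReal_biUnion_finset_le W _)
  intro ω hω
  by_contra hne
  simp only [Set.mem_iUnion, not_exists, Set.mem_ofPred_eq, not_not] at hne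
  rcases hω with ⟨⟨h1, h2⟩, h3⟩ | ⟨⟨h1, h2⟩, h3⟩
  · exact h3 ⟨hA _ _ hne h1, h2⟩
  · exact h3 ⟨hA _ _ (fun i hi => (hne i hi).symm) h1, h2⟩

theorem IsParkingProcess.tendsto_gridConfig_univ (h : IsParkingProcess P N m) (t s : ℝ≥0)
    {W : Finset ℤ} {A : Set (ℤ → Fin 4 × ℕ)} (hA : IsLocal W A) :
    Tendsto (fun n : ℕ => P.real {ω | gridConfig (incr N (mesh t s ((n + 1) ^ 3)) ω)
      ((n + 1) ^ 3) ∈ A}) atTop (𝓝 (P.real {ω | config N m t ω ∈ A})) := by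
  simpa using h.tendsto_gridConfig t s hA MeasurableSet.univ

/-- Later arrivals are independent of the present configuration. -/
theorem IsParkingProcess.measureReal_config_and (h : IsParkingProcess P N m) (t s : ℝ≥0)
    {W : Finset ℤ} {A : Set (ℤ → Fin 4 × ℕ)} (hA : IsLocal W A) {F : Set (ℤ → ℕ)}
    (hF : MeasurableSet F) :
    P.real {ω | config N m t ω ∈ A ∧ (fun i => N i (t + s) ω - N i t ω) ∈ F} =
      P.real {ω | config N m t ω ∈ A} *
        P.real {ω | (fun i => N i (t + s) ω - N i t ω) ∈ F} := by
  have hB : MeasurableSet {ω | (fun i => N i (t + s) ω - N i t ω) ∈ F} :=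
    (measurable_pi_lambda _ fun i =>
      ((h.poisson i).measurable _).sub ((h.poisson i).measurable _)) hF
  refine tendsto_nhds_unique (h.tendsto_gridConfig t s hA hB)
    (((h.tendsto_gridConfig_univ t s hA).mul_const _).congr fun n => ?_)
  have hk : (n + 1) ^ 3 ≠ 0 := by positivity
  have := h.measureReal_gridConfig_and (mesh_monotone t s hk) ((n + 1) ^ 3) hA.measurableSet hF
  -- The increments of the extra last mesh step are the arrivals in `(t, t + s]`.
  simp only [incr, mesh_self t s hk, mesh_succ_self] at this
  exact this.symm

/-- Given that no car has arrived at `a`, the configurations to the left and to the right of `a`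
are independent copies of the configuration to the right of `0` given that no car has
arrived at `0`. -/
theorem IsParkingProcess.measureReal_split (h : IsParkingProcess P N m) (t : ℝ≥0) (a : ℤ)
    (S' S : Set ((Fin 4 × ℕ) × (Fin 4 × ℕ))) :
    P.real {ω | N a t ω = 0 ∧ (config N m t ω (a - 1), config N m t ω (a - 2)) ∈ S' ∧
        (config N m t ω (a + 1), config N m t ω (a + 2)) ∈ S} * Real.exp (-t) =
      P.real {ω | N 0 t ω = 0 ∧ (config N m t ω 1, config N m t ω 2) ∈ S'} *
        P.real {ω | N 0 t ω = 0 ∧ (config N m t ω 1, config N m t ω 2) ∈ S} := by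
  have := h.isProbabilityMeasure
  let E (a : ℤ) (S' S : Set ((Fin 4 × ℕ) × (Fin 4 × ℕ))) : Set (ℤ → Fin 4 × ℕ) :=
    {c | (c a).2 = 0 ∧ (c (a - 1), c (a - 2)) ∈ S' ∧ (c (a + 1), c (a + 2)) ∈ S}
  have hE : ∀ a S' S, IsLocal {a - 2, a - 1, a, a + 1, a + 2} (E a S' S) := by
    intro a S' S c c' hcc
    simp only [Finset.mem_insert, Finset.mem_singleton, forall_eq_or_imp, forall_eq] at hcc
    obtain ⟨h1, h2, h3, h4, h5⟩ := hcc
    simp only [E, Set.mem_ofPred_eq, h1, h2, h3, h4, h5, imp_self]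
  have hlim := fun a S' S => h.tendsto_gridConfig_univ t 0 (hE a S' S)
  -- In discrete time all three probabilities factor into `exp (-t)` and half-line probabilities;
  -- taking `Set.univ` on the left of site `0` produces the one-sided ones. Both sides therefore
  -- agree before the limit.
  have key := tendsto_nhds_unique ((hlim a S' S).mul_const (Real.exp (-t)))
    (((hlim 0 Set.univ S').mul (hlim 0 Set.univ S)).congr fun n => ?_)
  · refine key.trans ?_
    congr 2 <;> simp [E, config]
  · have hk : (n + 1) ^ 3 ≠ 0 := by positivity
    have hs := fun a S' S => h.measureReal_gridConfig_split (mesh_monotone t 0 hk)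
      (mesh_zero t 0 _) a ((n + 1) ^ 3) S' S
    simp only [mesh_self t 0 hk] at hs
    change P.real {ω | _ ∧ _ ∧ _} * P.real {ω | _ ∧ _ ∧ _} = P.real {ω | _ ∧ _ ∧ _} * _
    rw [hs, hs, hs]
    simp only [Set.mem_univ, Set.ofPred_true, probReal_univ]
    ring

theorem IsParkingProcess.ae_of_tendsto (h : IsParkingProcess P N m) (t : ℝ≥0) {W : Finset ℤ}
    {A : Set (ℤ → Fin 4 × ℕ)} (hA : IsLocal W A)
    (hlim : Tendsto (fun n : ℕ => P.real {ω | gridConfig (incr N (mesh t 0 ((n + 1) ^ 3)) ω)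
      ((n + 1) ^ 3) ∈ A}) atTop (𝓝 0)) : ∀ᵐ ω ∂P, config N m t ω ∉ A := by
  have := h.isProbabilityMeasure
  have h0 := tendsto_nhds_unique (h.tendsto_gridConfig_univ t 0 hA) hlim
  rw [measureReal_eq_zero_iff] at h0
  exact measure_eq_zero_iff_ae_notMem.1 h0

theorem IsParkingProcess.ae_blocked (h : IsParkingProcess P N m) (t : ℝ≥0) :
    ∀ᵐ ω ∂P, ∀ i, m i t ω = 0 → N i t ω ≠ 0 → arrive (m (i - 1) t ω) 0 (m (i + 1) t ω) = 0 := by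
  refine ae_all_iff.2 fun i => ?_
  have hA : IsLocal {i - 1, i, i + 1} {c : ℤ → Fin 4 × ℕ | ¬ ((c i).1 = 0 → (c i).2 ≠ 0 →
      arrive (c (i - 1)).1 0 (c (i + 1)).1 = 0)} := by
    intro c c' hcc
    simp only [Finset.mem_insert, Finset.mem_singleton, forall_eq_or_imp, forall_eq] at hcc
    obtain ⟨h1, h2, h3⟩ := hcc
    simp only [Set.mem_ofPred_eq, h1, h2, h3, imp_self]
  refine (h.ae_of_tendsto t hA ?_).mono fun ω hω => not_not.1 hω
  refine tendsto_const_nhds.congr fun n => ?_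
  have : {ω | gridConfig (incr N (mesh t 0 ((n + 1) ^ 3)) ω) ((n + 1) ^ 3) ∈
      {c : ℤ → Fin 4 × ℕ | ¬ ((c i).1 = 0 → (c i).2 ≠ 0 →
        arrive (c (i - 1)).1 0 (c (i + 1)).1 = 0)}} = ∅ :=
    Set.eq_empty_of_forall_notMem fun ω hω => hω (gridConfig_blocked _ _ i)
  rw [this, measureReal_empty]

/-- In discrete time the equivalence fails only if some step brings two cars to `i`, which has
probability at most `t ^ 2 / k`. -/
theorem IsParkingProcess.ae_isolated (h : IsParkingProcess P N m) (t : ℝ≥0) :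
    ∀ᵐ ω ∂P, ∀ i, N (i - 1) t ω = 0 → N (i + 1) t ω = 0 → (m i t ω = 1 ↔ N i t ω = 1) := by
  have := h.isProbabilityMeasure
  refine ae_all_iff.2 fun i => ?_
  have hA : IsLocal {i - 1, i, i + 1} {c : ℤ → Fin 4 × ℕ | ¬ ((c (i - 1)).2 = 0 →
      (c (i + 1)).2 = 0 → ((c i).1 = 1 ↔ (c i).2 = 1))} := by
    intro c c' hcc
    simp only [Finset.mem_insert, Finset.mem_singleton, forall_eq_or_imp, forall_eq] at hcc
    obtain ⟨h1, h2, h3⟩ := hcc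
    simp only [Set.mem_ofPred_eq, h1, h2, h3, imp_self]
  refine (h.ae_of_tendsto t hA ?_).mono fun ω hω => not_not.1 hω
  refine squeeze_zero (fun _ => measureReal_nonneg) (fun n => ?_) (tendsto_div_cube ((t : ℝ) ^ 2))
  have hk : (n + 1) ^ 3 ≠ 0 := by positivity
  set k := (n + 1) ^ 3
  have hτ := mesh_monotone t 0 hk
  have hk' : (k : ℝ) ≠ 0 := by exact_mod_cast hk
  calc P.real {ω | gridConfig (incr N (mesh t 0 k) ω) k ∈ {c : ℤ → Fin 4 × ℕ |
        ¬ ((c (i - 1)).2 = 0 → (c (i + 1)).2 = 0 → ((c i).1 = 1 ↔ (c i).2 = 1))}}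
      ≤ P.real (⋃ j ∈ Finset.range k, {ω | 2 ≤ incr N (mesh t 0 k) ω (i, j)}) := by
        refine measureReal_mono (fun ω hω => ?_) (measure_ne_top _ _)
        by_contra hne
        simp only [Set.mem_iUnion, not_exists, Set.mem_ofPred_eq, Finset.mem_range] at hne
        exact hω fun hl hr => gridConfig_isolated hl hr fun j hj => by
          have := hne j hj
          omega
    _ ≤ ∑ j ∈ Finset.range k, P.real {ω | 2 ≤ incr N (mesh t 0 k) ω (i, j)} :=
        measureReal_biUnion_finset_le _ _
    _ ≤ (Finset.range k).card • ((t : ℝ) ^ 2 / k ^ 2) := by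
        refine Finset.sum_le_card_nsmul _ _ _ fun j hj => ?_
        refine (h.measureReal_two_le_incr hτ (i, j)).trans ?_
        rw [mesh_sub t 0 (Finset.mem_range.1 hj)]
        push_cast
        rw [div_pow]
    _ = (t : ℝ) ^ 2 / k := by
        rw [Finset.card_range, nsmul_eq_mul]
        field_simp
    _ ≤ (2 * (n : ℝ) + 1) ^ 2 * ((t : ℝ) ^ 2 / k) := by
        refine le_mul_of_one_le_left (by positivity) ?_
        nlinarith [(Nat.cast_nonneg n : (0 : ℝ) ≤ n)]

theorem IsParkingProcess.ae_vacant (h : IsParkingProcess P N m) (t : ℝ≥0) :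
    ∀ᵐ ω ∂P, ∀ i, N i t ω = 0 → m i t ω = 0 := by
  have hz : ∀ᵐ ω ∂P, ∀ i, N i 0 ω = 0 := ae_all_iff.2 fun i => (h.poisson i).zero
  filter_upwards [hz, h.path] with ω hz hpath i hi
  rw [hpath.noArrival i 0 t zero_le (hi.trans (hz i).symm), hpath.start]

end TwoLineParking

end

/-! ### The evolution equation for local events. -/

noncomputable section

namespace TwoLineParking

open Filter Topology

variable {Ω : Type*} [MeasurableSpace Ω] {P : Measure Ω} {N : ℤ → ℝ≥0 → Ω → ℕ}
  {m : ℤ → ℝ≥0 → Ω → Fin 4}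

/-- The effect of no arrival, or of one arrival at a given site, on a configuration. -/
def act : Option ℤ → (ℤ → Fin 4 × ℕ) → ℤ → Fin 4 × ℕ
  | none => id
  | some i => hit i

/-- The numbers of arrivals when there is no arrival, or one arrival at a given site. -/
def arrivals : Option ℤ → ℤ → ℕ
  | none => 0
  | some i => Pi.single i 1

theorem IsLocal.act {V W : Finset ℤ} {A : Set (ℤ → Fin 4 × ℕ)} (hA : IsLocal V A)
    (hV : ∀ i ∈ V, i - 1 ∈ W ∧ i ∈ W ∧ i + 1 ∈ W) (e : Option ℤ) :
    IsLocal W {c | act e c ∈ A} := by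
  intro c c' hc
  refine hA _ _ fun j hj => ?_
  obtain ⟨h1, h2, h3⟩ := hV j hj
  cases e with
  | none => exact hc j h2
  | some i =>
    rcases eq_or_ne j i with rfl | hji
    · simp [TwoLineParking.act, hit, hc _ h1, hc _ h2, hc _ h3]
    · simp [TwoLineParking.act, hit, hji, hc _ h2]

theorem hit_mem_iff {V : Finset ℤ} {A : Set (ℤ → Fin 4 × ℕ)} (hA : IsLocal V A) {i : ℤ}
    (hi : i ∉ V) (c : ℤ → Fin 4 × ℕ) : hit i c ∈ A ↔ c ∈ A := by
  have : ∀ j ∈ V, hit i c j = c j := fun j hj =>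
    Function.update_of_ne (ne_of_mem_of_not_mem hj hi) _ _
  exact ⟨hA _ _ this, hA _ _ fun j hj => (this j hj).symm⟩

theorem IsParkingProcess.measureReal_increments (h : IsParkingProcess P N m) (t s : ℝ≥0)
    (W : Finset ℤ) (x : ℤ → ℕ) :
    P.real {ω | ∀ i ∈ W, N i (t + s) ω - N i t ω = x i} =
      ∏ i ∈ W, (Real.exp (-s) * s ^ x i / (x i).factorial) := by
  have hi := h.indep.comp (fun _ y => y (t + s) - y t) fun _ =>
    (measurable_pi_apply (t + s)).sub (measurable_pi_apply t)
  have key := hi.measure_inter_preimage_eq_mul W (sets := fun i => {x i}) fun _ _ => .of_discrete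
  have hset : {ω | ∀ i ∈ W, N i (t + s) ω - N i t ω = x i} = ⋂ i ∈ W,
      ((fun y : ℝ≥0 → ℕ => y (t + s) - y t) ∘ fun ω => fun t => N i t ω) ⁻¹' {x i} := by
    ext ω
    simp
  rw [measureReal_def, hset, key, ENNReal.toReal_prod]
  refine Finset.prod_congr rfl fun i _ => ?_
  have hl := (h.poisson i).increment_law t (t + s) le_self_add
  rw [add_tsub_cancel_left] at hl
  rw [← poissonMeasure_real_singleton]
  exact hl.measureReal_eq (p := (· = x i)) .of_discrete

theorem IsParkingProcess.measureReal_arrivals (h : IsParkingProcess P N m) (t s : ℝ≥0)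
    {W : Finset ℤ} {e : Option ℤ} (he : e ∈ Finset.insertNone W) :
    P.real {ω | ∀ i ∈ W, N i (t + s) ω - N i t ω = arrivals e i} =
      Real.exp (-(W.card * s)) * (if e = none then 1 else (s : ℝ)) := by
  rw [h.measureReal_increments]
  have hexp : ∏ _i ∈ W, Real.exp (-(s : ℝ)) = Real.exp (-(W.card * s)) := by
    rw [Finset.prod_const, ← Real.exp_nat_mul]
    ring_nf
  cases e with
  | none => simpa [arrivals] using hexp
  | some i =>
    have hi : i ∈ W := Finset.some_mem_insertNone.1 he
    rw [if_neg (by simp), ← hexp]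
    have : ∀ j ∈ W, Real.exp (-(s : ℝ)) * s ^ arrivals (some i) j /
        (arrivals (some i) j).factorial = Real.exp (-(s : ℝ)) * if j = i then (s : ℝ) else 1 := by
      intro j _
      by_cases hji : j = i <;> simp [arrivals, hji]
    rw [Finset.prod_congr rfl this, Finset.prod_mul_distrib, Finset.prod_ite_eq' W i, if_pos hi]

/-- `W` contains the neighbours of `V`, so an arrival pattern with at most one car in `W` determines
the new configuration on `V`, whatever happens outside `W`. -/
theorem IsParkingProcess.ae_config_add (h : IsParkingProcess P N m) (t s : ℝ≥0)
    {V W : Finset ℤ} (hV : ∀ i ∈ V, i - 1 ∈ W ∧ i ∈ W ∧ i + 1 ∈ W) :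
    ∀ᵐ ω ∂P, ∀ e, (∀ i ∈ W, N i (t + s) ω - N i t ω = arrivals e i) →
      ∀ j ∈ V, config N m (t + s) ω j = act e (config N m t ω) j := by
  have hmono : ∀ᵐ ω ∂P, ∀ i, Monotone fun t => N i t ω :=
    ae_all_iff.2 fun i => (h.poisson i).monotone
  have hts : t ≤ t + s := le_self_add
  filter_upwards [hmono, h.path] with ω hmono hpath e he j hj
  obtain ⟨h1, h2, h3⟩ := hV j hj
  have hN : ∀ i ∈ W, N i (t + s) ω = N i t ω + arrivals e i := by
    intro i hi
    have := hmono i hts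
    have := he i hi
    simp only at *
    omega
  have hstay : arrivals e j = 0 → config N m (t + s) ω j = config N m t ω j := fun h0 =>
    Prod.ext (hpath.noArrival j t (t + s) hts (by simp [hN j h2, h0])) (by simp [config, hN j h2,
        h0])
  cases e with
  | none => exact hstay rfl
  | some i =>
    rcases eq_or_ne j i with rfl | hji
    · have e1 := hN _ h1
      have e2 := hN _ h2
      have e3 := hN _ h3
      simp only [arrivals, Pi.single_apply, sub_eq_self, one_ne_zero, if_false, add_zero,
        if_true, add_eq_left] at e1 e2 e3
      simp only [act, hit, Function.update_self, config]
      exact Prod.ext (hpath.oneArrival j t (t + s) hts e2 e1 e3) e2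
    · rw [hstay (by simp [arrivals, hji])]
      simp [act, hit, hji]

theorem exp_neg_estimates {y : ℝ} (hy : 0 ≤ y) :
    1 - y ≤ Real.exp (-y) ∧ Real.exp (-y) ≤ 1 ∧ Real.exp (-y) ≤ 1 - y + y ^ 2 := by
  refine ⟨Real.one_sub_le_exp_neg y, Real.exp_le_one_iff.2 (by linarith), ?_⟩
  have h1 : Real.exp (-y) * (1 + y) ≤ 1 := by
    have := Real.add_one_le_exp y
    calc Real.exp (-y) * (1 + y) ≤ Real.exp (-y) * Real.exp y := by
          gcongr
          linarith
      _ = 1 := by rw [← Real.exp_add]; simp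
  have h2 : 1 ≤ (1 - y + y ^ 2) * (1 + y) := by nlinarith [pow_nonneg hy 3]
  exact le_of_mul_le_mul_right (h1.trans h2) (by linarith)

/-- The event is split according to the arrivals in `W` during `(t, t + s]`: none, one at a given
site, or more. The first two cases factor by independence of later arrivals and give the linear
term; the last has probability of order `s ^ 2`. -/
theorem IsParkingProcess.abs_increment_sub_le (h : IsParkingProcess P N m) (t s : ℝ≥0)
    {V W : Finset ℤ} {A : Set (ℤ → Fin 4 × ℕ)} (hA : IsLocal V A)
    (hV : ∀ i ∈ V, i - 1 ∈ W ∧ i ∈ W ∧ i + 1 ∈ W) :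
    |P.real {ω | config N m (t + s) ω ∈ A} - P.real {ω | config N m t ω ∈ A} -
      s * ∑ i ∈ W, (P.real {ω | hit i (config N m t ω) ∈ A} - P.real {ω | config N m t ω ∈ A})| ≤
      2 * W.card ^ 2 * (s : ℝ) ^ 2 := by
  have := h.isProbabilityMeasure
  let F (e : Option ℤ) : Set (ℤ → ℕ) := {x | ∀ i ∈ W, x i = arrivals e i}
  have hF : ∀ e, MeasurableSet (F e) := by
    intro e
    have : F e = ⋂ i ∈ W, (fun x : ℤ → ℕ => x i) ⁻¹' {arrivals e i} := by
      ext x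
      simp [F]
    rw [this]
    exact Finset.measurableSet_biInter _ fun i _ =>
      measurable_pi_apply i (measurableSet_singleton _)
  let Q (e : Option ℤ) : Set Ω := {ω | (fun i => N i (t + s) ω - N i t ω) ∈ F e}
  have hQ : ∀ e, MeasurableSet (Q e) := fun e =>
    (measurable_pi_lambda _ fun i =>
      ((h.poisson i).measurable _).sub ((h.poisson i).measurable _)) (hF e)
  have hQP : ∀ e ∈ Finset.insertNone W, P.real (Q e) =
      Real.exp (-(W.card * s)) * (if e = none then 1 else (s : ℝ)) :=
    fun e he => h.measureReal_arrivals t s he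
  have hdisj : Set.PairwiseDisjoint (↑(Finset.insertNone W)) Q := by
    intro e he e' he' hne
    refine Set.disjoint_left.2 fun ω hω hω' => hne ?_
    have hee : ∀ i ∈ W, arrivals e i = arrivals e' i := fun i hi =>
      (hω i hi).symm.trans (hω' i hi)
    rcases e with _ | i <;> rcases e' with _ | i'
    · rfl
    · have := hee i' (Finset.some_mem_insertNone.1 he')
      simp [arrivals] at this
    · have := hee i (Finset.some_mem_insertNone.1 he)
      simp [arrivals] at this
    · have := hee i (Finset.some_mem_insertNone.1 he)
      by_contra hii
      have hii' : i ≠ i' := fun hh => hii (congrArg some hh)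
      simp [arrivals, hii'] at this
  let X : Set Ω := {ω | config N m (t + s) ω ∈ A}
  have hX : MeasurableSet X := (h.measurable_config _) hA.measurableSet
  let U : Set Ω := ⋃ e ∈ Finset.insertNone W, Q e
  have hU : MeasurableSet U := Finset.measurableSet_biUnion _ fun e _ => hQ e
  have hXQ : ∀ e ∈ Finset.insertNone W, P.real (X ∩ Q e) =
      P.real {ω | act e (config N m t ω) ∈ A} * P.real (Q e) := by
    intro e _
    have := h.measureReal_config_and t s (hA.act hV e) (hF e)
    refine Eq.trans (measureReal_congr ?_) this
    filter_upwards [h.ae_config_add t s hV] with ω hω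
    refine propext (and_congr_left fun hq => ?_)
    have := hω e hq
    exact ⟨hA _ _ this, hA _ _ fun j hj => (this j hj).symm⟩
  have hXU : P.real (X ∩ U) = ∑ e ∈ Finset.insertNone W,
      P.real {ω | act e (config N m t ω) ∈ A} * P.real (Q e) := by
    rw [Set.inter_iUnion₂, measureReal_biUnion_finset
      (fun e he e' he' hne => (hdisj he he' hne).mono Set.inter_subset_right Set.inter_subset_right)
      fun e _ => hX.inter (hQ e)]
    exact Finset.sum_congr rfl hXQ
  have hPU : P.real U = ∑ e ∈ Finset.insertNone W, P.real (Q e) :=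
    measureReal_biUnion_finset hdisj fun e _ => hQ e
  have hsplit := measureReal_inter_add_sdiff (μ := P) (s := X) hU
  have hθ : P.real (X \ U) ≤ 1 - P.real U := by
    rw [← probReal_compl_eq_one_sub hU]
    exact measureReal_mono fun ω hω => hω.2
  have hθ0 : 0 ≤ P.real (X \ U) := measureReal_nonneg
  set x := Real.exp (-(W.card * s)) with hx
  have hPU' : P.real U = x + W.card * (x * s) := by
    rw [hPU, Finset.sum_congr rfl hQP, Finset.sum_insertNone]
    simp
  have hXU' : P.real (X ∩ U) = P.real {ω | config N m t ω ∈ A} * x +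
      (∑ i ∈ W, P.real {ω | hit i (config N m t ω) ∈ A}) * (x * s) := by
    rw [hXU, Finset.sum_congr rfl fun e he => congrArg (_ * ·) (hQP e he), Finset.sum_insertNone,
      Finset.sum_mul]
    simp [act]
  rw [Finset.sum_sub_distrib, Finset.sum_const, nsmul_eq_mul]
  change |P.real X - _ - _| ≤ _
  rw [← hsplit, hXU']
  rw [hPU'] at hθ
  have ha0 : 0 ≤ P.real {ω | config N m t ω ∈ A} := measureReal_nonneg
  have ha1 : P.real {ω | config N m t ω ∈ A} ≤ 1 := measureReal_le_one
  set a := P.real {ω | config N m t ω ∈ A}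
  have hS0 : 0 ≤ ∑ i ∈ W, P.real {ω | hit i (config N m t ω) ∈ A} :=
    Finset.sum_nonneg fun _ _ => measureReal_nonneg
  have hS1 : ∑ i ∈ W, P.real {ω | hit i (config N m t ω) ∈ A} ≤ W.card := by
    refine (Finset.sum_le_card_nsmul _ _ 1 fun _ _ => measureReal_le_one).trans ?_
    simp
  set S := ∑ i ∈ W, P.real {ω | hit i (config N m t ω) ∈ A}
  have hs : (0 : ℝ) ≤ s := s.coe_nonneg
  have hy : (0 : ℝ) ≤ W.card * s := by positivity
  obtain ⟨hx1, hx2, hx3⟩ := exp_neg_estimates hy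
  rw [← hx] at hx1 hx2 hx3
  set y : ℝ := W.card * s with hydef
  have hSs0 : 0 ≤ S * s := by positivity
  have hSs1 : S * s ≤ y := by
    rw [hydef]
    gcongr
  -- With `y = W.card * s`, each of the three error terms lies between `0` and `y ^ 2` before its
  -- sign is counted; two are positive and one is negative, whence the constant `2`.
  have e1 : a * x + S * (x * s) + P.real (X \ U) - a - s * (S - W.card * a) =
      a * (x - 1 + y) - (S * s) * (1 - x) + P.real (X \ U) := by
    rw [hydef]
    ring
  have e2 : 2 * (W.card : ℝ) ^ 2 * (s : ℝ) ^ 2 = 2 * y ^ 2 := by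
    rw [hydef]
    ring
  rw [e1, e2]
  have b1 : a * (x - 1 + y) ≤ 1 * y ^ 2 :=
    mul_le_mul ha1 (by linarith) (by linarith) zero_le_one
  have b1' : 0 ≤ a * (x - 1 + y) := mul_nonneg ha0 (by linarith)
  have b2 : (S * s) * (1 - x) ≤ y * y := mul_le_mul hSs1 (by linarith) (by linarith) hy
  have b2' : 0 ≤ (S * s) * (1 - x) := mul_nonneg hSs0 (by linarith)
  have b3 : P.real (X \ U) ≤ y ^ 2 := by
    have : W.card * (x * s) = x * y := by
      rw [hydef]
      ring
    rw [this] at hθ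
    nlinarith
  rw [abs_le]
  constructor <;> nlinarith

theorem IsParkingProcess.abs_measureReal_sub_le (h : IsParkingProcess P N m) (t s : ℝ≥0)
    {W : Finset ℤ} {A : Set (ℤ → Fin 4 × ℕ)} (hA : IsLocal W A) :
    |P.real {ω | config N m (t + s) ω ∈ A} - P.real {ω | config N m t ω ∈ A}| ≤ W.card * s := by
  have := h.isProbabilityMeasure
  have m1 : ∀ t, MeasurableSet {ω | config N m t ω ∈ A} := fun t =>
    (h.measurable_config t) hA.measurableSet
  refine (abs_measureReal_sub_le_measureReal_symmDiff (m1 _).nullMeasurableSet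
    (m1 _).nullMeasurableSet).trans ?_
  have hle : ∀ i ∈ W, P.real {ω | N i (t + s) ω - N i t ω ≠ 0} ≤ s := fun i _ => by
    have hl := (h.poisson i).increment_law t (t + s) le_self_add
    rw [add_tsub_cancel_left] at hl
    rw [hl.measureReal_eq (p := (· ≠ 0)) .of_discrete]
    exact poissonMeasure_real_ne_zero_le s
  refine le_trans ?_ ((measureReal_biUnion_finset_le W _).trans
    ((Finset.sum_le_card_nsmul _ _ _ hle).trans_eq (nsmul_eq_mul _ _)))
  rw [measureReal_def, measureReal_def]
  refine ENNReal.toReal_mono (measure_ne_top _ _) (measure_mono_ae ?_)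
  have hmono : ∀ᵐ ω ∂P, ∀ i, Monotone fun t => N i t ω :=
    ae_all_iff.2 fun i => (h.poisson i).monotone
  have hts : t ≤ t + s := le_self_add
  filter_upwards [hmono, h.path] with ω hmono hpath hω
  change ω ∈ ⋃ i ∈ W, {ω | N i (t + s) ω - N i t ω ≠ 0}
  by_contra hne
  simp only [Set.mem_iUnion, not_exists, Set.mem_ofPred_eq, not_not] at hne
  have hc : ∀ i ∈ W, config N m (t + s) ω i = config N m t ω i := by
    intro i hi
    have h1 := hmono i hts
    have h2 := hne i hi
    have h3 : N i (t + s) ω = N i t ω := by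
      simp only at h1
      omega
    exact Prod.ext (hpath.noArrival i t (t + s) hts h3) h3
  rcases hω with ⟨h1, h2⟩ | ⟨h1, h2⟩
  · exact h2 (hA _ _ hc h1)
  · exact h2 (hA _ _ (fun i hi => (hc i hi).symm) h1)

/-- The estimate looks forward in time only. For a point `u` to the left of `t` it is applied from
`u`, and the Lipschitz bound replaces `r u` by `r t`; this doubles the constant. -/
theorem hasDerivWithinAt_of_quadratic {g r : ℝ → ℝ} {C : ℝ}
    (hg : ∀ t s, 0 ≤ t → 0 ≤ s → |g (t + s) - g t - s * r t| ≤ C * s ^ 2)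
    (hr : ∀ t s, 0 ≤ t → 0 ≤ s → |r (t + s) - r t| ≤ C * s) {t : ℝ} (ht : 0 ≤ t) :
    HasDerivWithinAt g (r t) (Set.Ici 0) t := by
  rw [hasDerivWithinAt_iff_isLittleO]
  have hbig : (fun u => g u - g t - (u - t) • r t) =O[𝓝[Set.Ici 0] t] fun u => ‖u - t‖ ^ 2 := by
    refine Asymptotics.IsBigO.of_bound (2 * C) ?_
    filter_upwards [self_mem_nhdsWithin] with u hu
    have hu0 : 0 ≤ u := hu
    simp only [smul_eq_mul, Real.norm_eq_abs, sq_abs, abs_sq]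
    rcases le_total t u with htu | hut
    · have h1 := hg t (u - t) ht (sub_nonneg.2 htu)
      rw [add_sub_cancel] at h1
      nlinarith [abs_nonneg (g u - g t - (u - t) * r t)]
    · have h1 := hg u (t - u) hu0 (sub_nonneg.2 hut)
      have h2 := hr u (t - u) hu0 (sub_nonneg.2 hut)
      rw [add_sub_cancel] at h1 h2
      have e : g u - g t - (u - t) * r t =
          -(g t - g u - (t - u) * r u) + (t - u) * (r t - r u) := by ring
      rw [e]
      refine (abs_add_le _ _).trans ?_
      rw [abs_neg, abs_mul, abs_of_nonneg (sub_nonneg.2 hut)]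
      nlinarith [mul_le_mul_of_nonneg_left h2 (sub_nonneg.2 hut)]
  refine hbig.trans_isLittleO ?_
  exact (Asymptotics.isLittleO_pow_sub_sub t one_lt_two).mono nhdsWithin_le_nhds

/-- The evolution equation for the probability of a local event. -/
theorem IsParkingProcess.hasDerivWithinAt (h : IsParkingProcess P N m) {V : Finset ℤ}
    {A : Set (ℤ → Fin 4 × ℕ)} (hA : IsLocal V A) {t : ℝ} (ht : 0 ≤ t) :
    HasDerivWithinAt (fun t : ℝ => P.real {ω | config N m t.toNNReal ω ∈ A})
      (∑ i ∈ V, (P.real {ω | hit i (config N m t.toNNReal ω) ∈ A} -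
        P.real {ω | config N m t.toNNReal ω ∈ A})) (Set.Ici 0) t := by
  let W : Finset ℤ := V ∪ (V.image (· - 1) ∪ V.image (· + 1))
  have hV : ∀ i ∈ V, i - 1 ∈ W ∧ i ∈ W ∧ i + 1 ∈ W := fun i hi =>
    ⟨Finset.mem_union_right _ (Finset.mem_union_left _ (Finset.mem_image_of_mem _ hi)),
      Finset.mem_union_left _ hi,
      Finset.mem_union_right _ (Finset.mem_union_right _ (Finset.mem_image_of_mem _ hi))⟩
  -- A car outside `V` does not affect `A`, so enlarging the sum to `W` adds only zeros.
  have hsum : ∀ t : ℝ≥0, ∑ i ∈ V, (P.real {ω | hit i (config N m t ω) ∈ A} -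
      P.real {ω | config N m t ω ∈ A}) = ∑ i ∈ W, (P.real {ω | hit i (config N m t ω) ∈ A} -
        P.real {ω | config N m t ω ∈ A}) := fun t => by
    refine Finset.sum_subset (fun i hi => (hV i hi).2.1) fun i _ hi => ?_
    simp only [hit_mem_iff hA hi, sub_self]
  refine hasDerivWithinAt_of_quadratic (C := 2 * W.card ^ 2)
    (r := fun t => ∑ i ∈ V, (P.real {ω | hit i (config N m t.toNNReal ω) ∈ A} -
        P.real {ω | config N m t.toNNReal ω ∈ A})) ?_ ?_ ht
  · intro t s ht hs
    have := h.abs_increment_sub_le t.toNNReal s.toNNReal hA hV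
    rw [Real.coe_toNNReal s hs] at this
    simpa only [hsum, Real.toNNReal_add ht hs] using this
  · intro t s ht hs
    simp only [hsum, Real.toNNReal_add ht hs, ← Finset.sum_sub_distrib]
    have hle : ∀ B, IsLocal W B → |P.real {ω | config N m (t.toNNReal + s.toNNReal) ω ∈ B} -
        P.real {ω | config N m t.toNNReal ω ∈ B}| ≤ W.card * s := fun B hB => by
      simpa only [Real.coe_toNNReal s hs] using h.abs_measureReal_sub_le t.toNNReal s.toNNReal hB
    refine (Finset.abs_sum_le_sum_abs _ _).trans
      ((Finset.sum_le_card_nsmul _ _ (2 * (W.card * s)) fun i _ => ?_).trans_eq ?_)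
    · have h1 := hle _ (hA.act hV (some i))
      have h2 := hle _ (hA.act hV none)
      simp only [TwoLineParking.act, Set.mem_ofPred_eq, id] at h1 h2
      rw [sub_sub_sub_comm]
      exact (abs_sub _ _).trans (by linarith)
    · rw [nsmul_eq_mul]
      ring

end TwoLineParking

end

/-! ### Factorized probabilities, and the evolution equation for the densities in question. -/

noncomputable section

namespace TwoLineParking

variable {Ω : Type*} [MeasurableSpace Ω] {P : Measure Ω} {N : ℤ → ℝ≥0 → Ω → ℕ}
  {m : ℤ → ℝ≥0 → Ω → Fin 4}

theorem measurable_arrive {x y z : Ω → Fin 4} (hx : Measurable x) (hy : Measurable y)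
    (hz : Measurable z) : Measurable fun ω => arrive (x ω) (y ω) (z ω) :=
  (measurable_of_countable fun p : Fin 4 × Fin 4 × Fin 4 => arrive p.1 p.2.1 p.2.2).comp
    (hx.prodMk (hy.prodMk hz))

/-- A linear relation that holds almost surely between indicators of events holds between
the probabilities. -/
theorem sum_measureReal_eq_zero [IsFiniteMeasure P] (l : List (ℤ × (Ω → Bool)))
    (hl : ∀ x ∈ l, MeasurableSet {ω | x.2 ω})
    (h : ∀ᵐ ω ∂P, (l.map fun x => if x.2 ω then x.1 else 0).sum = 0) :
    (l.map fun x => (x.1 : ℝ) * P.real {ω | x.2 ω}).sum = 0 := by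
  have key : ∀ l : List (ℤ × (Ω → Bool)), (∀ x ∈ l, MeasurableSet {ω | x.2 ω}) →
      Integrable (fun ω => (((l.map fun x => if x.2 ω then x.1 else 0).sum : ℤ) : ℝ)) P ∧
      ∫ ω, (((l.map fun x => if x.2 ω then x.1 else 0).sum : ℤ) : ℝ) ∂P =
        (l.map fun x => (x.1 : ℝ) * P.real {ω | x.2 ω}).sum := by
    intro l
    induction l with
    | nil => simp
    | cons x l ih =>
      intro hl
      obtain ⟨h1, h2⟩ := ih fun y hy => hl y (List.mem_cons_of_mem x hy)
      have hx := hl x List.mem_cons_self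
      have e : (fun ω => (((if x.2 ω then x.1 else 0 : ℤ)) : ℝ)) =
          Set.indicator {ω | x.2 ω} fun _ => (x.1 : ℝ) := by
        funext ω
        by_cases hω : x.2 ω <;> simp [hω]
      have hi : Integrable (fun ω => (((if x.2 ω then x.1 else 0 : ℤ)) : ℝ)) P := by
        rw [e]
        exact (integrable_const _).indicator hx
      simp only [List.map_cons, List.sum_cons, Int.cast_add]
      refine ⟨hi.add h1, ?_⟩
      rw [integral_add hi h1, h2, e, integral_indicator_const _ hx, smul_eq_mul, mul_comm]
  rw [← (key l hl).2]
  refine integral_eq_zero_of_ae ?_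
  filter_upwards [h] with ω hω
  simp [hω]

theorem IsParkingProcess.f_eq (h : IsParkingProcess P N m) (s : Fin 4) (t : ℝ) :
    f P N m s t = Real.exp t.toNNReal *
      P.real {ω | N 0 t.toNNReal ω = 0 ∧ m 1 t.toNNReal ω = s} := by
  have h1 := h.measureReal_eq_zero 0 t.toNNReal
  have h2 : MeasurableSet {ω | N 0 t.toNNReal ω = 0} :=
    (h.poisson 0).measurable t.toNNReal (measurableSet_singleton 0)
  rw [f, measureReal_def, cond_apply h2, ENNReal.toReal_mul, ENNReal.toReal_inv]
  change (P.real {ω | N 0 t.toNNReal ω = 0})⁻¹ * P.real _ = _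
  rw [h1, Real.exp_neg, inv_inv]
  rfl

theorem IsParkingProcess.R_eq (h : IsParkingProcess P N m) (t : ℝ) :
    R P N m t = Real.exp t.toNNReal *
      P.real {ω | N 0 t.toNNReal ω = 0 ∧ m 1 t.toNNReal ω = 1 ∧ m 2 t.toNNReal ω = 0} := by
  have h1 := h.measureReal_eq_zero 0 t.toNNReal
  have h2 : MeasurableSet {ω | N 0 t.toNNReal ω = 0} :=
    (h.poisson 0).measurable t.toNNReal (measurableSet_singleton 0)
  rw [R, measureReal_def, cond_apply h2, ENNReal.toReal_mul, ENNReal.toReal_inv]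
  change (P.real {ω | N 0 t.toNNReal ω = 0})⁻¹ * P.real _ = _
  rw [h1, Real.exp_neg, inv_inv]
  rfl

theorem IsParkingProcess.measureReal_split' (h : IsParkingProcess P N m) (t : ℝ≥0) (a : ℤ)
    (S' S : Set ((Fin 4 × ℕ) × (Fin 4 × ℕ))) :
    P.real {ω | N a t ω = 0 ∧ (config N m t ω (a - 1), config N m t ω (a - 2)) ∈ S' ∧
        (config N m t ω (a + 1), config N m t ω (a + 2)) ∈ S} =
      Real.exp t * P.real {ω | N 0 t ω = 0 ∧ (config N m t ω 1, config N m t ω 2) ∈ S'} *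
        P.real {ω | N 0 t ω = 0 ∧ (config N m t ω 1, config N m t ω 2) ∈ S} := by
  rw [mul_assoc, ← h.measureReal_split t a S' S, mul_comm (Real.exp t), mul_assoc, ← Real.exp_add]
  simp

theorem IsParkingProcess.measureReal_arrived (h : IsParkingProcess P N m) (t : ℝ≥0)
    (W : Finset ℤ) (x : ℤ → ℕ) :
    P.real {ω | ∀ i ∈ W, N i t ω = x i} =
      ∏ i ∈ W, (Real.exp (-t) * t ^ x i / (x i).factorial) := by
  rw [← h.measureReal_increments 0 t W x]
  have hz : ∀ᵐ ω ∂P, ∀ i, N i 0 ω = 0 := ae_all_iff.2 fun i => (h.poisson i).zero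
  refine measureReal_congr ?_
  filter_upwards [hz] with ω hω
  refine propext (forall₂_congr fun i _ => ?_)
  simp [hω]

theorem IsParkingProcess.measureReal_neighbours (h : IsParkingProcess P N m) (t : ℝ)
    (a b : Fin 4) :
    P.real {ω | N 0 t.toNNReal ω = 0 ∧ m (-1) t.toNNReal ω = a ∧ m 1 t.toNNReal ω = b} =
      f P N m a t * f P N m b t * Real.exp (-t.toNNReal) := by
  have := h.measureReal_split' t.toNNReal 0 {p | p.1.1 = a} {p | p.1.1 = b}
  simp only [config, Set.mem_ofPred_eq, zero_sub, zero_add] at this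
  rw [this, h.f_eq, h.f_eq, Real.exp_neg]
  field_simp

/-- Site `1` is the wall; the condition on site `0` belongs to its left side. -/
theorem IsParkingProcess.measureReal_second_neighbour (h : IsParkingProcess P N m) (t : ℝ)
    (r : Fin 4) :
    P.real {ω | N 0 t.toNNReal ω = 0 ∧ N 1 t.toNNReal ω = 0 ∧ m 2 t.toNNReal ω = r} =
      f P N m r t * Real.exp (-t.toNNReal) ^ 2 := by
  have h1 := h.measureReal_split' t.toNNReal 1 {p | p.1.2 = 0} {p | p.1.1 = r}
  have h2 := h.measureReal_arrived t.toNNReal {0, 1} 0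
  rw [h.f_eq]
  generalize t.toNNReal = T at *
  simp only [Finset.mem_insert, Finset.mem_singleton, forall_eq_or_imp, forall_eq, Pi.zero_apply,
    pow_zero, Nat.factorial_zero, Nat.cast_one, mul_one, div_one, Finset.prod_const,
    Finset.card_pair zero_ne_one] at h2
  simp only [config, Set.mem_ofPred_eq, sub_self, one_add_one_eq_two, h2] at h1
  rw [mul_right_comm, ← h1]
  congr 1
  ext ω
  simp only [Set.mem_ofPred_eq]
  tauto

/-- Site `2` is the wall. The arrival counts at `0`, `1`, `2` are independent Poisson variables, and
the single arrival at `1` supplies the factor `t`. -/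
theorem IsParkingProcess.measureReal_third_neighbour (h : IsParkingProcess P N m) (t : ℝ)
    (r : Fin 4) :
    P.real {ω | N 0 t.toNNReal ω = 0 ∧ N 1 t.toNNReal ω = 1 ∧ N 2 t.toNNReal ω = 0 ∧
      m 3 t.toNNReal ω = r} = f P N m r t * t.toNNReal * Real.exp (-t.toNNReal) ^ 3 := by
  have h1 := h.measureReal_split' t.toNNReal 2 {p | p.1.2 = 1 ∧ p.2.2 = 0} {p | p.1.1 = r}
  have h2 := h.measureReal_arrived t.toNNReal {0, 1, 2} (Pi.single 1 1)
  rw [h.f_eq]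
  generalize t.toNNReal = T at *
  have h3 : P.real {ω | N 0 T ω = 0 ∧ N 1 T ω = 1 ∧ N 2 T ω = 0} = T * Real.exp (-T) ^ 3 := by
    rw [Finset.prod_insert (by simp), Finset.prod_pair (by norm_num)] at h2
    simp [Pi.single_apply] at h2
    rw [h2]
    ring
  simp only [config, Set.mem_ofPred_eq, sub_self, show (2 : ℤ) - 1 = 1 by norm_num,
    show (2 : ℤ) + 1 = 3 by norm_num, h3, and_assoc] at h1
  refine Eq.trans ?_ (h1.trans (by ring))
  congr 1
  ext ω
  simp only [Set.mem_ofPred_eq]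
  tauto

/-- Seen from the wall at `1`, the pair of states at `0` and `-1` is the mirror image of the event
defining `R`. -/
theorem IsParkingProcess.measureReal_right (h : IsParkingProcess P N m) (t : ℝ) (r : Fin 4) :
    P.real {ω | m (-1) t.toNNReal ω = 0 ∧ m 0 t.toNNReal ω = 1 ∧ N 1 t.toNNReal ω = 0 ∧
      m 2 t.toNNReal ω = r} = R P N m t * f P N m r t * Real.exp (-t.toNNReal) := by
  have h1 := h.measureReal_split' t.toNNReal 1 {p | p.1.1 = 1 ∧ p.2.1 = 0} {p | p.1.1 = r}
  rw [h.f_eq, h.R_eq, Real.exp_neg]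
  generalize t.toNNReal = T at *
  simp only [config, Set.mem_ofPred_eq, sub_self, one_add_one_eq_two,
    show (1 : ℤ) - 2 = -1 by norm_num] at h1
  refine Eq.trans ?_ (h1.trans (by field_simp))
  congr 1
  ext ω
  simp only [Set.mem_ofPred_eq]
  tauto

theorem IsParkingProcess.measureReal_left (h : IsParkingProcess P N m) (t : ℝ) (r : Fin 4) :
    P.real {ω | m 1 t.toNNReal ω = 0 ∧ m 0 t.toNNReal ω = 1 ∧ N (-1) t.toNNReal ω = 0 ∧
      m (-2) t.toNNReal ω = r} = R P N m t * f P N m r t * Real.exp (-t.toNNReal) := by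
  have h1 := h.measureReal_split' t.toNNReal (-1) {p | p.1.1 = r} {p | p.1.1 = 1 ∧ p.2.1 = 0}
  rw [h.f_eq, h.R_eq, Real.exp_neg]
  generalize t.toNNReal = T at *
  simp only [config, Set.mem_ofPred_eq, neg_add_cancel, show (-1 : ℤ) - 1 = -2 by norm_num,
    show (-1 : ℤ) + 2 = 1 by norm_num] at h1
  refine Eq.trans ?_ (h1.trans (by field_simp))
  congr 1
  ext ω
  simp only [Set.mem_ofPred_eq]
  tauto

theorem IsParkingProcess.hasDerivWithinAt_D (h : IsParkingProcess P N m) (s : Fin 4) {t : ℝ}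
    (ht : 0 ≤ t) : HasDerivWithinAt (D P m s) (P.real {ω | arrive (m (-1) t.toNNReal ω)
      (m 0 t.toNNReal ω) (m 1 t.toNNReal ω) = s} - D P m s t) (Set.Ici 0) t := by
  have hA : IsLocal {0} {c : ℤ → Fin 4 × ℕ | (c 0).1 = s} := by
    intro c c' hc
    simp only [Finset.mem_singleton, forall_eq] at hc
    simp only [Set.mem_ofPred_eq, hc, imp_self]
  refine (h.hasDerivWithinAt hA ht).congr_deriv ?_
  rw [Finset.sum_singleton]
  simp [hit, config, D]

/-- A car at `0` destroys the condition `N 0 = 0`, so site `0` contributes only a loss; site `1`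
contributes the other one. -/
theorem IsParkingProcess.hasDerivWithinAt_q (h : IsParkingProcess P N m) (s : Fin 4) {t : ℝ}
    (ht : 0 ≤ t) : HasDerivWithinAt
      (fun t : ℝ => P.real {ω | N 0 t.toNNReal ω = 0 ∧ m 1 t.toNNReal ω = s})
      (P.real {ω | N 0 t.toNNReal ω = 0 ∧ arrive (m 0 t.toNNReal ω) (m 1 t.toNNReal ω)
        (m 2 t.toNNReal ω) = s} - 2 * P.real {ω | N 0 t.toNNReal ω = 0 ∧ m 1 t.toNNReal ω = s})
      (Set.Ici 0) t := by
  have hA : IsLocal {0, 1} {c : ℤ → Fin 4 × ℕ | (c 0).2 = 0 ∧ (c 1).1 = s} := by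
    intro c c' hc
    simp only [Finset.mem_insert, Finset.mem_singleton, forall_eq_or_imp, forall_eq] at hc
    obtain ⟨h1, h2⟩ := hc
    simp only [Set.mem_ofPred_eq, h1, h2, imp_self]
  refine (h.hasDerivWithinAt hA ht).congr_deriv ?_
  rw [Finset.sum_pair (by norm_num)]
  simp [hit, config]
  ring

theorem IsParkingProcess.hasDerivWithinAt_q₂ (h : IsParkingProcess P N m) {t : ℝ}
    (ht : 0 ≤ t) : HasDerivWithinAt
      (fun t : ℝ => P.real {ω | N 0 t.toNNReal ω = 0 ∧ m 1 t.toNNReal ω = 1 ∧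
        m 2 t.toNNReal ω = 0})
      (P.real {ω | N 0 t.toNNReal ω = 0 ∧ arrive (m 0 t.toNNReal ω) (m 1 t.toNNReal ω)
          (m 2 t.toNNReal ω) = 1 ∧ m 2 t.toNNReal ω = 0} +
        P.real {ω | N 0 t.toNNReal ω = 0 ∧ m 1 t.toNNReal ω = 1 ∧ arrive (m 1 t.toNNReal ω)
          (m 2 t.toNNReal ω) (m 3 t.toNNReal ω) = 0} -
        3 * P.real {ω | N 0 t.toNNReal ω = 0 ∧ m 1 t.toNNReal ω = 1 ∧ m 2 t.toNNReal ω = 0})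
      (Set.Ici 0) t := by
  have hA : IsLocal {0, 1, 2}
      {c : ℤ → Fin 4 × ℕ | (c 0).2 = 0 ∧ (c 1).1 = 1 ∧ (c 2).1 = 0} := by
    intro c c' hc
    simp only [Finset.mem_insert, Finset.mem_singleton, forall_eq_or_imp, forall_eq] at hc
    obtain ⟨h1, h2, h3⟩ := hc
    simp only [Set.mem_ofPred_eq, h1, h2, h3, imp_self]
  refine (h.hasDerivWithinAt hA ht).congr_deriv ?_
  rw [Finset.sum_insert (by simp), Finset.sum_pair (by norm_num)]
  simp [hit, config]
  ring

theorem IsParkingProcess.hasDerivWithinAt_D₃ (h : IsParkingProcess P N m) {t : ℝ}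
    (ht : 0 ≤ t) : HasDerivWithinAt (D₃ P m 0 1 0)
      (P.real {ω | arrive (m (-2) t.toNNReal ω) (m (-1) t.toNNReal ω) (m 0 t.toNNReal ω) = 0 ∧
          m 0 t.toNNReal ω = 1 ∧ m 1 t.toNNReal ω = 0} +
        P.real {ω | m (-1) t.toNNReal ω = 0 ∧ arrive (m (-1) t.toNNReal ω) (m 0 t.toNNReal ω)
          (m 1 t.toNNReal ω) = 1 ∧ m 1 t.toNNReal ω = 0} +
        P.real {ω | m (-1) t.toNNReal ω = 0 ∧ m 0 t.toNNReal ω = 1 ∧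
          arrive (m 0 t.toNNReal ω) (m 1 t.toNNReal ω) (m 2 t.toNNReal ω) = 0} -
        3 * D₃ P m 0 1 0 t) (Set.Ici 0) t := by
  have hA : IsLocal {-1, 0, 1}
      {c : ℤ → Fin 4 × ℕ | (c (-1)).1 = 0 ∧ (c 0).1 = 1 ∧ (c 1).1 = 0} := by
    intro c c' hc
    simp only [Finset.mem_insert, Finset.mem_singleton, forall_eq_or_imp, forall_eq] at hc
    obtain ⟨h1, h2, h3⟩ := hc
    simp only [Set.mem_ofPred_eq, h1, h2, h3, imp_self]
  refine (h.hasDerivWithinAt hA ht).congr_deriv ?_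
  rw [Finset.sum_insert (by simp), Finset.sum_pair (by norm_num)]
  simp [hit, config, D₃]
  ring

end TwoLineParking

end

/-! ### Evaluation of the gain and loss terms by case distinction on states. -/

noncomputable section

namespace TwoLineParking

variable {Ω : Type*} [MeasurableSpace Ω] {P : Measure Ω} {N : ℤ → ℝ≥0 → Ω → ℕ}
  {m : ℤ → ℝ≥0 → Ω → Fin 4}

/-- Almost surely, the facts about the sites `i - 1`, `i`, `i + 1` that hold at a fixed time. -/
theorem IsParkingProcess.ae_site (h : IsParkingProcess P N m) (t : ℝ≥0) :
    ∀ᵐ ω ∂P, ∀ i, (N i t ω = 0 → m i t ω = 0) ∧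
      (N i t ω ≠ 0 → m i t ω = 0 → arrive (m (i - 1) t ω) 0 (m (i + 1) t ω) = 0) ∧
      (N (i - 1) t ω = 0 → N (i + 1) t ω = 0 → (m i t ω = 1 ↔ N i t ω = 1)) := by
  filter_upwards [h.ae_vacant t, h.ae_blocked t, h.ae_isolated t] with ω h1 h2 h3 i
  exact ⟨h1 i, fun hn hm => h2 i hm hn, h3 i⟩

/-- Blocking restricts every successful parking at a vacant site to `N 0 = 0`. The accepting
neighbour pairs are those with entries in `{0, 2}` (the car goes to the first line) and those with
entries in `{0, 1}` other than `(0, 0)` (second line). -/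
theorem IsParkingProcess.measureReal_arrive_eq_zero (h : IsParkingProcess P N m) (t : ℝ) :
    P.real {ω | arrive (m (-1) t.toNNReal ω) (m 0 t.toNNReal ω) (m 1 t.toNNReal ω) = 0} =
      D P m 0 t - (f P N m 0 t + f P N m 2 t) ^ 2 * Real.exp (-t.toNNReal) -
        (2 * f P N m 0 t * f P N m 1 t + f P N m 1 t ^ 2) * Real.exp (-t.toNNReal) := by
  have := h.isProbabilityMeasure
  have hm := fun i => h.measurable i t.toNNReal
  have hN := fun i => (h.poisson i).measurable t.toNNReal
  have e1 := h.measureReal_neighbours t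
  have hs := h.ae_site t.toNNReal
  simp only [D]
  generalize t.toNNReal = T at *
  -- The identity is a signed sum of indicators that vanishes almost surely. Once `N 0 T ω = 0` is
  -- decided and the relevant fact from `ae_site` is inserted, this is a finite check over the
  -- states. The later evaluations follow the same pattern.
  have key := sum_measureReal_eq_zero (P := P)
    [(1, fun ω => decide (arrive (m (-1) T ω) (m 0 T ω) (m 1 T ω) = 0)),
      (-1, fun ω => decide (m 0 T ω = 0)),
      (1, fun ω => decide (N 0 T ω = 0 ∧ m (-1) T ω = 0 ∧ m 1 T ω = 0)),
      (1, fun ω => decide (N 0 T ω = 0 ∧ m (-1) T ω = 0 ∧ m 1 T ω = 2)),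
      (1, fun ω => decide (N 0 T ω = 0 ∧ m (-1) T ω = 2 ∧ m 1 T ω = 0)),
      (1, fun ω => decide (N 0 T ω = 0 ∧ m (-1) T ω = 2 ∧ m 1 T ω = 2)),
      (1, fun ω => decide (N 0 T ω = 0 ∧ m (-1) T ω = 0 ∧ m 1 T ω = 1)),
      (1, fun ω => decide (N 0 T ω = 0 ∧ m (-1) T ω = 1 ∧ m 1 T ω = 0)),
      (1, fun ω => decide (N 0 T ω = 0 ∧ m (-1) T ω = 1 ∧ m 1 T ω = 1))] ?_ ?_
  · simp only [List.map_cons, List.map_nil, List.sum_cons, List.sum_nil, decide_eq_true_eq,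
      e1] at key
    push_cast at key
    linarith
  · have ha := measurable_arrive (hm (-1)) (hm 0) (hm 1)
    simp only [List.forall_mem_cons, List.not_mem_nil, false_imp_iff, implies_true, and_true,
      decide_eq_true_eq]
    refine ⟨?_, ?_, ?_, ?_, ?_, ?_, ?_, ?_, ?_⟩ <;> measurability
  · filter_upwards [hs] with ω hω
    simp only [List.map_cons, List.map_nil, List.sum_cons, List.sum_nil, decide_eq_true_eq]
    obtain ⟨h1, h2, -⟩ := hω 0
    simp only [zero_sub, zero_add] at h2
    generalize m (-1) T ω = l at *
    generalize m 0 T ω = c at *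
    generalize m 1 T ω = r at *
    by_cases hn : N 0 T ω = 0
    · simp only [hn, true_and, h1 hn]
      clear h1 h2 hn
      revert l r
      decide
    · have := h2 hn
      simp only [hn, false_and]
      clear h1 h2 hn
      revert l c r
      decide

theorem IsParkingProcess.measureReal_arrive_eq_one (h : IsParkingProcess P N m) (t : ℝ) :
    P.real {ω | arrive (m (-1) t.toNNReal ω) (m 0 t.toNNReal ω) (m 1 t.toNNReal ω) = 1} =
      D P m 1 t + (f P N m 0 t + f P N m 2 t) ^ 2 * Real.exp (-t.toNNReal) - D₃ P m 0 1 0 t := by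
  have := h.isProbabilityMeasure
  have hm := fun i => h.measurable i t.toNNReal
  have hN := fun i => (h.poisson i).measurable t.toNNReal
  have e1 := h.measureReal_neighbours t
  have hs := h.ae_site t.toNNReal
  simp only [D, D₃]
  generalize t.toNNReal = T at *
  have key := sum_measureReal_eq_zero (P := P)
    [(1, fun ω => decide (arrive (m (-1) T ω) (m 0 T ω) (m 1 T ω) = 1)),
      (-1, fun ω => decide (m 0 T ω = 1)),
      (1, fun ω => decide (m (-1) T ω = 0 ∧ m 0 T ω = 1 ∧ m 1 T ω = 0)),
      (-1, fun ω => decide (N 0 T ω = 0 ∧ m (-1) T ω = 0 ∧ m 1 T ω = 0)),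
      (-1, fun ω => decide (N 0 T ω = 0 ∧ m (-1) T ω = 0 ∧ m 1 T ω = 2)),
      (-1, fun ω => decide (N 0 T ω = 0 ∧ m (-1) T ω = 2 ∧ m 1 T ω = 0)),
      (-1, fun ω => decide (N 0 T ω = 0 ∧ m (-1) T ω = 2 ∧ m 1 T ω = 2))] ?_ ?_
  · simp only [List.map_cons, List.map_nil, List.sum_cons, List.sum_nil, decide_eq_true_eq,
      e1] at key
    push_cast at key
    linarith
  · have ha := measurable_arrive (hm (-1)) (hm 0) (hm 1)
    simp only [List.forall_mem_cons, List.not_mem_nil, false_imp_iff, implies_true, and_true,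
      decide_eq_true_eq]
    refine ⟨?_, ?_, ?_, ?_, ?_, ?_, ?_⟩ <;> measurability
  · filter_upwards [hs] with ω hω
    simp only [List.map_cons, List.map_nil, List.sum_cons, List.sum_nil, decide_eq_true_eq]
    obtain ⟨h1, h2, -⟩ := hω 0
    simp only [zero_sub, zero_add] at h2
    generalize m (-1) T ω = l at *
    generalize m 0 T ω = c at *
    generalize m 1 T ω = r at *
    by_cases hn : N 0 T ω = 0
    · simp only [hn, true_and, h1 hn]
      clear h1 h2 hn
      revert l r
      decide
    · have := h2 hn
      simp only [hn, false_and]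
      clear h1 h2 hn
      revert l c r
      decide

theorem IsParkingProcess.measureReal_arrive_eq_two (h : IsParkingProcess P N m) (t : ℝ) :
    P.real {ω | arrive (m (-1) t.toNNReal ω) (m 0 t.toNNReal ω) (m 1 t.toNNReal ω) = 2} =
      D P m 2 t + (2 * f P N m 0 t * f P N m 1 t + f P N m 1 t ^ 2) * Real.exp (-t.toNNReal) := by
  have := h.isProbabilityMeasure
  have hm := fun i => h.measurable i t.toNNReal
  have hN := fun i => (h.poisson i).measurable t.toNNReal
  have e1 := h.measureReal_neighbours t
  have hs := h.ae_site t.toNNReal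
  simp only [D]
  generalize t.toNNReal = T at *
  have key := sum_measureReal_eq_zero (P := P)
    [(1, fun ω => decide (arrive (m (-1) T ω) (m 0 T ω) (m 1 T ω) = 2)),
      (-1, fun ω => decide (m 0 T ω = 2)),
      (-1, fun ω => decide (N 0 T ω = 0 ∧ m (-1) T ω = 0 ∧ m 1 T ω = 1)),
      (-1, fun ω => decide (N 0 T ω = 0 ∧ m (-1) T ω = 1 ∧ m 1 T ω = 0)),
      (-1, fun ω => decide (N 0 T ω = 0 ∧ m (-1) T ω = 1 ∧ m 1 T ω = 1))] ?_ ?_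
  · simp only [List.map_cons, List.map_nil, List.sum_cons, List.sum_nil, decide_eq_true_eq,
      e1] at key
    push_cast at key
    linarith
  · have ha := measurable_arrive (hm (-1)) (hm 0) (hm 1)
    simp only [List.forall_mem_cons, List.not_mem_nil, false_imp_iff, implies_true, and_true,
      decide_eq_true_eq]
    refine ⟨?_, ?_, ?_, ?_, ?_⟩ <;> measurability
  · filter_upwards [hs] with ω hω
    simp only [List.map_cons, List.map_nil, List.sum_cons, List.sum_nil, decide_eq_true_eq]
    obtain ⟨h1, h2, -⟩ := hω 0
    simp only [zero_sub, zero_add] at h2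
    generalize m (-1) T ω = l at *
    generalize m 0 T ω = c at *
    generalize m 1 T ω = r at *
    by_cases hn : N 0 T ω = 0
    · simp only [hn, true_and, h1 hn]
      clear h1 h2 hn
      revert l r
      decide
    · have := h2 hn
      simp only [hn, false_and]
      clear h1 h2 hn
      revert l c r
      decide

theorem IsParkingProcess.measureReal_arrive_eq_three (h : IsParkingProcess P N m) (t : ℝ) :
    P.real {ω | arrive (m (-1) t.toNNReal ω) (m 0 t.toNNReal ω) (m 1 t.toNNReal ω) = 3} =
      D P m 3 t + D₃ P m 0 1 0 t := by
  have := h.isProbabilityMeasure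
  have hm := fun i => h.measurable i t.toNNReal
  have hN := fun i => (h.poisson i).measurable t.toNNReal
  simp only [D, D₃]
  generalize t.toNNReal = T at *
  have key := sum_measureReal_eq_zero (P := P)
    [(1, fun ω => decide (arrive (m (-1) T ω) (m 0 T ω) (m 1 T ω) = 3)),
      (-1, fun ω => decide (m 0 T ω = 3)),
      (-1, fun ω => decide (m (-1) T ω = 0 ∧ m 0 T ω = 1 ∧ m 1 T ω = 0))] ?_ ?_
  · simp only [List.map_cons, List.map_nil, List.sum_cons, List.sum_nil, decide_eq_true_eq] at key
    push_cast at key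
    linarith
  · have ha := measurable_arrive (hm (-1)) (hm 0) (hm 1)
    simp only [List.forall_mem_cons, List.not_mem_nil, false_imp_iff, implies_true, and_true,
      decide_eq_true_eq]
    refine ⟨?_, ?_, ?_⟩ <;> measurability
  · refine ae_of_all _ fun ω => ?_
    simp only [List.map_cons, List.map_nil, List.sum_cons, List.sum_nil, decide_eq_true_eq]
    generalize m (-1) T ω = l
    generalize m 0 T ω = c
    generalize m 1 T ω = r
    revert l c r
    decide

/-- With `N 0 = 0` the left neighbour of site `1` is vacant, so an untouched site `1` rejects its
car only if site `2` is in state `3`. -/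
theorem IsParkingProcess.measureReal_half_arrive_eq_zero (h : IsParkingProcess P N m) (t : ℝ) :
    P.real {ω | N 0 t.toNNReal ω = 0 ∧
        arrive (m 0 t.toNNReal ω) (m 1 t.toNNReal ω) (m 2 t.toNNReal ω) = 0} =
      P.real {ω | N 0 t.toNNReal ω = 0 ∧ m 1 t.toNNReal ω = 0} -
        (f P N m 0 t + f P N m 1 t + f P N m 2 t) * Real.exp (-t.toNNReal) ^ 2 := by
  have := h.isProbabilityMeasure
  have hm := fun i => h.measurable i t.toNNReal
  have hN := fun i => (h.poisson i).measurable t.toNNReal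
  have e1 := h.measureReal_second_neighbour t
  have hs := h.ae_site t.toNNReal
  generalize t.toNNReal = T at *
  have key := sum_measureReal_eq_zero (P := P)
    [(1, fun ω => decide (N 0 T ω = 0 ∧ arrive (m 0 T ω) (m 1 T ω) (m 2 T ω) = 0)),
      (-1, fun ω => decide (N 0 T ω = 0 ∧ m 1 T ω = 0)),
      (1, fun ω => decide (N 0 T ω = 0 ∧ N 1 T ω = 0 ∧ m 2 T ω = 0)),
      (1, fun ω => decide (N 0 T ω = 0 ∧ N 1 T ω = 0 ∧ m 2 T ω = 1)),
      (1, fun ω => decide (N 0 T ω = 0 ∧ N 1 T ω = 0 ∧ m 2 T ω = 2))] ?_ ?_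
  · simp only [List.map_cons, List.map_nil, List.sum_cons, List.sum_nil, decide_eq_true_eq,
      e1] at key
    push_cast at key
    linarith
  · have ha := measurable_arrive (hm 0) (hm 1) (hm 2)
    simp only [List.forall_mem_cons, List.not_mem_nil, false_imp_iff, implies_true, and_true,
      decide_eq_true_eq]
    refine ⟨?_, ?_, ?_, ?_, ?_⟩ <;> measurability
  · filter_upwards [hs] with ω hω
    simp only [List.map_cons, List.map_nil, List.sum_cons, List.sum_nil, decide_eq_true_eq]
    obtain ⟨h1, -, -⟩ := hω 0
    obtain ⟨h2, h3, -⟩ := hω 1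
    simp only [sub_self, one_add_one_eq_two] at h3
    generalize m 0 T ω = l at *
    generalize m 1 T ω = c at *
    generalize m 2 T ω = r at *
    by_cases hn : N 0 T ω = 0
    · by_cases hn' : N 1 T ω = 0
      · simp only [hn, hn', true_and, h1 hn, h2 hn']
        clear h1 h2 h3
        revert r
        decide
      · have := h3 hn'
        rw [h1 hn] at this
        simp only [hn, hn', true_and, false_and, h1 hn]
        clear h1 h2 h3
        revert c r
        decide
    · simp [hn]

theorem IsParkingProcess.measureReal_half_arrive_eq_one (h : IsParkingProcess P N m) (t : ℝ) :
    P.real {ω | N 0 t.toNNReal ω = 0 ∧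
        arrive (m 0 t.toNNReal ω) (m 1 t.toNNReal ω) (m 2 t.toNNReal ω) = 1} =
      P.real {ω | N 0 t.toNNReal ω = 0 ∧ m 1 t.toNNReal ω = 1} + (f P N m 0 t + f P N m 2 t) *
          Real.exp (-t.toNNReal) ^ 2 -
        P.real {ω | N 0 t.toNNReal ω = 0 ∧ m 1 t.toNNReal ω = 1 ∧ m 2 t.toNNReal ω = 0} := by
  have := h.isProbabilityMeasure
  have hm := fun i => h.measurable i t.toNNReal
  have hN := fun i => (h.poisson i).measurable t.toNNReal
  have e1 := h.measureReal_second_neighbour t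
  have hs := h.ae_site t.toNNReal
  generalize t.toNNReal = T at *
  have key := sum_measureReal_eq_zero (P := P)
    [(1, fun ω => decide (N 0 T ω = 0 ∧ arrive (m 0 T ω) (m 1 T ω) (m 2 T ω) = 1)),
      (-1, fun ω => decide (N 0 T ω = 0 ∧ m 1 T ω = 1)),
      (1, fun ω => decide (N 0 T ω = 0 ∧ m 1 T ω = 1 ∧ m 2 T ω = 0)),
      (-1, fun ω => decide (N 0 T ω = 0 ∧ N 1 T ω = 0 ∧ m 2 T ω = 0)),
      (-1, fun ω => decide (N 0 T ω = 0 ∧ N 1 T ω = 0 ∧ m 2 T ω = 2))] ?_ ?_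
  · simp only [List.map_cons, List.map_nil, List.sum_cons, List.sum_nil, decide_eq_true_eq,
      e1] at key
    push_cast at key
    linarith
  · have ha := measurable_arrive (hm 0) (hm 1) (hm 2)
    simp only [List.forall_mem_cons, List.not_mem_nil, false_imp_iff, implies_true, and_true,
      decide_eq_true_eq]
    refine ⟨?_, ?_, ?_, ?_, ?_⟩ <;> measurability
  · filter_upwards [hs] with ω hω
    simp only [List.map_cons, List.map_nil, List.sum_cons, List.sum_nil, decide_eq_true_eq]
    obtain ⟨h1, -, -⟩ := hω 0
    obtain ⟨h2, h3, -⟩ := hω 1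
    simp only [sub_self, one_add_one_eq_two] at h3
    generalize m 0 T ω = l at *
    generalize m 1 T ω = c at *
    generalize m 2 T ω = r at *
    by_cases hn : N 0 T ω = 0
    · by_cases hn' : N 1 T ω = 0
      · simp only [hn, hn', true_and, h1 hn, h2 hn']
        clear h1 h2 h3
        revert r
        decide
      · have := h3 hn'
        rw [h1 hn] at this
        simp only [hn, hn', true_and, false_and, h1 hn]
        clear h1 h2 h3
        revert c r
        decide
    · simp [hn]

theorem IsParkingProcess.measureReal_half_arrive_eq_two (h : IsParkingProcess P N m) (t : ℝ) :
    P.real {ω | N 0 t.toNNReal ω = 0 ∧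
        arrive (m 0 t.toNNReal ω) (m 1 t.toNNReal ω) (m 2 t.toNNReal ω) = 2} =
      P.real {ω | N 0 t.toNNReal ω = 0 ∧ m 1 t.toNNReal ω = 2} + f P N m 1 t *
          Real.exp (-t.toNNReal) ^ 2 := by
  have := h.isProbabilityMeasure
  have hm := fun i => h.measurable i t.toNNReal
  have hN := fun i => (h.poisson i).measurable t.toNNReal
  have e1 := h.measureReal_second_neighbour t
  have hs := h.ae_site t.toNNReal
  generalize t.toNNReal = T at *
  have key := sum_measureReal_eq_zero (P := P)
    [(1, fun ω => decide (N 0 T ω = 0 ∧ arrive (m 0 T ω) (m 1 T ω) (m 2 T ω) = 2)),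
      (-1, fun ω => decide (N 0 T ω = 0 ∧ m 1 T ω = 2)),
      (-1, fun ω => decide (N 0 T ω = 0 ∧ N 1 T ω = 0 ∧ m 2 T ω = 1))] ?_ ?_
  · simp only [List.map_cons, List.map_nil, List.sum_cons, List.sum_nil, decide_eq_true_eq,
      e1] at key
    push_cast at key
    linarith
  · have ha := measurable_arrive (hm 0) (hm 1) (hm 2)
    simp only [List.forall_mem_cons, List.not_mem_nil, false_imp_iff, implies_true, and_true,
      decide_eq_true_eq]
    refine ⟨?_, ?_, ?_⟩ <;> measurability
  · filter_upwards [hs] with ω hω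
    simp only [List.map_cons, List.map_nil, List.sum_cons, List.sum_nil, decide_eq_true_eq]
    obtain ⟨h1, -, -⟩ := hω 0
    obtain ⟨h2, h3, -⟩ := hω 1
    simp only [sub_self, one_add_one_eq_two] at h3
    generalize m 0 T ω = l at *
    generalize m 1 T ω = c at *
    generalize m 2 T ω = r at *
    by_cases hn : N 0 T ω = 0
    · by_cases hn' : N 1 T ω = 0
      · simp only [hn, hn', true_and, h1 hn, h2 hn']
        clear h1 h2 h3
        revert r
        decide
      · have := h3 hn'
        rw [h1 hn] at this
        simp only [hn, hn', true_and, false_and, h1 hn]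
        clear h1 h2 h3
        revert c r
        decide
    · simp [hn]

theorem IsParkingProcess.measureReal_half_arrive_gain (h : IsParkingProcess P N m) (t : ℝ) :
    P.real {ω | N 0 t.toNNReal ω = 0 ∧
        arrive (m 0 t.toNNReal ω) (m 1 t.toNNReal ω) (m 2 t.toNNReal ω) = 1 ∧ m 2 t.toNNReal ω =
        0} =
      f P N m 0 t * Real.exp (-t.toNNReal) ^ 2 := by
  have := h.isProbabilityMeasure
  have hm := fun i => h.measurable i t.toNNReal
  have hN := fun i => (h.poisson i).measurable t.toNNReal
  have e1 := h.measureReal_second_neighbour t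
  have hs := h.ae_site t.toNNReal
  generalize t.toNNReal = T at *
  have key := sum_measureReal_eq_zero (P := P)
    [(1, fun ω => decide (N 0 T ω = 0 ∧ arrive (m 0 T ω) (m 1 T ω) (m 2 T ω) = 1 ∧ m 2 T ω = 0)),
      (-1, fun ω => decide (N 0 T ω = 0 ∧ N 1 T ω = 0 ∧ m 2 T ω = 0))] ?_ ?_
  · simp only [List.map_cons, List.map_nil, List.sum_cons, List.sum_nil, decide_eq_true_eq,
      e1] at key
    push_cast at key
    linarith
  · have ha := measurable_arrive (hm 0) (hm 1) (hm 2)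
    simp only [List.forall_mem_cons, List.not_mem_nil, false_imp_iff, implies_true, and_true,
      decide_eq_true_eq]
    refine ⟨?_, ?_⟩ <;> measurability
  · filter_upwards [hs] with ω hω
    simp only [List.map_cons, List.map_nil, List.sum_cons, List.sum_nil, decide_eq_true_eq]
    obtain ⟨h1, -, -⟩ := hω 0
    obtain ⟨h2, h3, -⟩ := hω 1
    simp only [sub_self, one_add_one_eq_two] at h3
    generalize m 0 T ω = l at *
    generalize m 1 T ω = c at *
    generalize m 2 T ω = r at *
    by_cases hn : N 0 T ω = 0
    · by_cases hn' : N 1 T ω = 0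
      · simp only [hn, hn', true_and, h1 hn, h2 hn']
        clear h1 h2 h3
        revert r
        decide
      · have := h3 hn'
        rw [h1 hn] at this
        simp only [hn, hn', true_and, false_and, h1 hn]
        clear h1 h2 h3
        revert c r
        decide
    · simp [hn]

/-- Next to state `1`, an untouched site `2` accepts a car exactly when site `3` is in state `0` or
`1`. Site `1` then lies between two sites without arrivals, so `m 1 = 1` may be replaced by `N 1 =
1`. -/
theorem IsParkingProcess.measureReal_half_arrive_loss (h : IsParkingProcess P N m) (t : ℝ) :
    P.real {ω | N 0 t.toNNReal ω = 0 ∧ m 1 t.toNNReal ω = 1 ∧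
        arrive (m 1 t.toNNReal ω) (m 2 t.toNNReal ω) (m 3 t.toNNReal ω) = 0} =
      P.real {ω | N 0 t.toNNReal ω = 0 ∧ m 1 t.toNNReal ω = 1 ∧ m 2 t.toNNReal ω = 0} -
        (f P N m 0 t + f P N m 1 t) * t.toNNReal * Real.exp (-t.toNNReal) ^ 3 := by
  have := h.isProbabilityMeasure
  have hm := fun i => h.measurable i t.toNNReal
  have hN := fun i => (h.poisson i).measurable t.toNNReal
  have e1 := h.measureReal_third_neighbour t
  have hs := h.ae_site t.toNNReal
  generalize t.toNNReal = T at *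
  have key := sum_measureReal_eq_zero (P := P)
    [(1, fun ω => decide (N 0 T ω = 0 ∧ m 1 T ω = 1 ∧ arrive (m 1 T ω) (m 2 T ω) (m 3 T ω) = 0)),
      (-1, fun ω => decide (N 0 T ω = 0 ∧ m 1 T ω = 1 ∧ m 2 T ω = 0)),
      (1, fun ω => decide (N 0 T ω = 0 ∧ N 1 T ω = 1 ∧ N 2 T ω = 0 ∧ m 3 T ω = 0)),
      (1, fun ω => decide (N 0 T ω = 0 ∧ N 1 T ω = 1 ∧ N 2 T ω = 0 ∧ m 3 T ω = 1))] ?_ ?_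
  · simp only [List.map_cons, List.map_nil, List.sum_cons, List.sum_nil, decide_eq_true_eq,
      e1] at key
    push_cast at key
    linarith
  · have ha := measurable_arrive (hm 1) (hm 2) (hm 3)
    simp only [List.forall_mem_cons, List.not_mem_nil, false_imp_iff, implies_true, and_true,
      decide_eq_true_eq]
    refine ⟨?_, ?_, ?_, ?_⟩ <;> measurability
  · filter_upwards [hs] with ω hω
    simp only [List.map_cons, List.map_nil, List.sum_cons, List.sum_nil, decide_eq_true_eq]
    obtain ⟨h1, -, -⟩ := hω 0
    obtain ⟨-, -, h2⟩ := hω 1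
    obtain ⟨h3, h4, -⟩ := hω 2
    simp only [sub_self, one_add_one_eq_two] at h2
    simp only [show (2 : ℤ) - 1 = 1 by norm_num, show (2 : ℤ) + 1 = 3 by norm_num] at h4
    generalize m 1 T ω = l at *
    generalize m 2 T ω = c at *
    generalize m 3 T ω = r at *
    by_cases hn : N 0 T ω = 0
    · by_cases hn' : N 2 T ω = 0
      · simp only [hn, hn', true_and, h3 hn', ← h2 hn hn']
        clear h1 h2 h3 h4
        revert l r
        decide
      · have := h4 hn'
        simp only [hn, hn', true_and, false_and, and_false]
        clear h1 h2 h3 h4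
        revert l c r
        decide
    · simp [hn]

/-- Between vacant neighbours only a vacant site can turn into state `1`, and it would accept a car,
so by blocking none has arrived there. -/
theorem IsParkingProcess.measureReal_triple_gain (h : IsParkingProcess P N m) (t : ℝ) :
    P.real {ω | m (-1) t.toNNReal ω = 0 ∧
        arrive (m (-1) t.toNNReal ω) (m 0 t.toNNReal ω) (m 1 t.toNNReal ω) = 1 ∧ m 1 t.toNNReal ω =
        0} =
      f P N m 0 t ^ 2 * Real.exp (-t.toNNReal) := by
  have := h.isProbabilityMeasure
  have hm := fun i => h.measurable i t.toNNReal
  have hN := fun i => (h.poisson i).measurable t.toNNReal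
  have e1 := h.measureReal_neighbours t
  have hs := h.ae_site t.toNNReal
  generalize t.toNNReal = T at *
  have key := sum_measureReal_eq_zero (P := P)
    [(1, fun ω => decide (m (-1) T ω = 0 ∧ arrive (m (-1) T ω) (m 0 T ω) (m 1 T ω) = 1 ∧ m 1 T ω =
          0)),
      (-1, fun ω => decide (N 0 T ω = 0 ∧ m (-1) T ω = 0 ∧ m 1 T ω = 0))] ?_ ?_
  · simp only [List.map_cons, List.map_nil, List.sum_cons, List.sum_nil, decide_eq_true_eq,
      e1] at key
    push_cast at key
    linarith
  · have ha := measurable_arrive (hm (-1)) (hm 0) (hm 1)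
    simp only [List.forall_mem_cons, List.not_mem_nil, false_imp_iff, implies_true, and_true,
      decide_eq_true_eq]
    refine ⟨?_, ?_⟩ <;> measurability
  · filter_upwards [hs] with ω hω
    simp only [List.map_cons, List.map_nil, List.sum_cons, List.sum_nil, decide_eq_true_eq]
    obtain ⟨h1, h2, -⟩ := hω 0
    simp only [zero_sub, zero_add] at h2
    generalize m (-1) T ω = l at *
    generalize m 0 T ω = c at *
    generalize m 1 T ω = r at *
    by_cases hn : N 0 T ω = 0
    · simp only [hn, true_and, h1 hn]
      clear h1 h2 hn
      revert l r
      decide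
    · have := h2 hn
      simp only [hn, false_and]
      clear h1 h2 hn
      revert l c r
      decide

/-- A car parks at the vacant site `1` beside state `1` only if `N 1 = 0` and site `2` is in state
`0` or `1`; site `1` is then a wall. -/
theorem IsParkingProcess.measureReal_triple_right_loss (h : IsParkingProcess P N m) (t : ℝ) :
    P.real {ω | m (-1) t.toNNReal ω = 0 ∧ m 0 t.toNNReal ω = 1 ∧
        arrive (m 0 t.toNNReal ω) (m 1 t.toNNReal ω) (m 2 t.toNNReal ω) = 0} =
      D₃ P m 0 1 0 t - R P N m t * (f P N m 0 t + f P N m 1 t) * Real.exp (-t.toNNReal) := by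
  have := h.isProbabilityMeasure
  have hm := fun i => h.measurable i t.toNNReal
  have hN := fun i => (h.poisson i).measurable t.toNNReal
  have e1 := h.measureReal_right t
  have hs := h.ae_site t.toNNReal
  simp only [D₃]
  generalize t.toNNReal = T at *
  have key := sum_measureReal_eq_zero (P := P)
    [(1, fun ω => decide (m (-1) T ω = 0 ∧ m 0 T ω = 1 ∧ arrive (m 0 T ω) (m 1 T ω) (m 2 T ω) = 0)),
      (-1, fun ω => decide (m (-1) T ω = 0 ∧ m 0 T ω = 1 ∧ m 1 T ω = 0)),
      (1, fun ω => decide (m (-1) T ω = 0 ∧ m 0 T ω = 1 ∧ N 1 T ω = 0 ∧ m 2 T ω = 0)),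
      (1, fun ω => decide (m (-1) T ω = 0 ∧ m 0 T ω = 1 ∧ N 1 T ω = 0 ∧ m 2 T ω = 1))] ?_ ?_
  · simp only [List.map_cons, List.map_nil, List.sum_cons, List.sum_nil, decide_eq_true_eq,
      e1] at key
    push_cast at key
    linarith
  · have ha := measurable_arrive (hm 0) (hm 1) (hm 2)
    simp only [List.forall_mem_cons, List.not_mem_nil, false_imp_iff, implies_true, and_true,
      decide_eq_true_eq]
    refine ⟨?_, ?_, ?_, ?_⟩ <;> measurability
  · filter_upwards [hs] with ω hω
    simp only [List.map_cons, List.map_nil, List.sum_cons, List.sum_nil, decide_eq_true_eq]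
    obtain ⟨h1, h2, -⟩ := hω 1
    simp only [sub_self, one_add_one_eq_two] at h2
    generalize m (-1) T ω = a at *
    generalize m 0 T ω = l at *
    generalize m 1 T ω = c at *
    generalize m 2 T ω = r at *
    by_cases hn : N 1 T ω = 0
    · simp only [hn, true_and, h1 hn]
      clear h1 h2 hn
      revert a l r
      decide
    · have := h2 hn
      simp only [hn, false_and, and_false]
      clear h1 h2 hn
      revert a l c r
      decide

theorem IsParkingProcess.measureReal_triple_left_loss (h : IsParkingProcess P N m) (t : ℝ) :
    P.real {ω | arrive (m (-2) t.toNNReal ω) (m (-1) t.toNNReal ω) (m 0 t.toNNReal ω) = 0 ∧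
        m 0 t.toNNReal ω = 1 ∧ m 1 t.toNNReal ω = 0} =
      D₃ P m 0 1 0 t - R P N m t * (f P N m 0 t + f P N m 1 t) * Real.exp (-t.toNNReal) := by
  have := h.isProbabilityMeasure
  have hm := fun i => h.measurable i t.toNNReal
  have hN := fun i => (h.poisson i).measurable t.toNNReal
  have e1 := h.measureReal_left t
  have hs := h.ae_site t.toNNReal
  simp only [D₃]
  generalize t.toNNReal = T at *
  have key := sum_measureReal_eq_zero (P := P)
    [(1, fun ω => decide (arrive (m (-2) T ω) (m (-1) T ω) (m 0 T ω) = 0 ∧ m 0 T ω = 1 ∧ m 1 T ω =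
          0)),
      (-1, fun ω => decide (m (-1) T ω = 0 ∧ m 0 T ω = 1 ∧ m 1 T ω = 0)),
      (1, fun ω => decide (m 1 T ω = 0 ∧ m 0 T ω = 1 ∧ N (-1) T ω = 0 ∧ m (-2) T ω = 0)),
      (1, fun ω => decide (m 1 T ω = 0 ∧ m 0 T ω = 1 ∧ N (-1) T ω = 0 ∧ m (-2) T ω = 1))] ?_ ?_
  · simp only [List.map_cons, List.map_nil, List.sum_cons, List.sum_nil, decide_eq_true_eq,
      e1] at key
    push_cast at key
    linarith
  · have ha := measurable_arrive (hm (-2)) (hm (-1)) (hm 0)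
    simp only [List.forall_mem_cons, List.not_mem_nil, false_imp_iff, implies_true, and_true,
      decide_eq_true_eq]
    refine ⟨?_, ?_, ?_, ?_⟩ <;> measurability
  · filter_upwards [hs] with ω hω
    simp only [List.map_cons, List.map_nil, List.sum_cons, List.sum_nil, decide_eq_true_eq]
    obtain ⟨h1, h2, -⟩ := hω (-1)
    simp only [neg_add_cancel, show (-1 : ℤ) - 1 = -2 by norm_num] at h2
    generalize m (-2) T ω = a at *
    generalize m (-1) T ω = l at *
    generalize m 0 T ω = c at *
    generalize m 1 T ω = r at *
    by_cases hn : N (-1) T ω = 0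
    · simp only [hn, true_and, h1 hn]
      clear h1 h2 hn
      revert a c r
      decide
    · have := h2 hn
      simp only [hn, false_and, and_false]
      clear h1 h2 hn
      revert a l c r
      decide

end TwoLineParking

end

/-! ### Initial values and removal of the conditioning. -/

noncomputable section

namespace TwoLineParking

variable {Ω : Type*} [MeasurableSpace Ω] {P : Measure Ω} {N : ℤ → ℝ≥0 → Ω → ℕ}
  {m : ℤ → ℝ≥0 → Ω → Fin 4}

theorem IsParkingProcess.ae_start (h : IsParkingProcess P N m) :
    ∀ᵐ ω ∂P, ∀ i, N i (0 : ℝ).toNNReal ω = 0 ∧ m i (0 : ℝ).toNNReal ω = 0 := by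
  have hz : ∀ᵐ ω ∂P, ∀ i, N i 0 ω = 0 := ae_all_iff.2 fun i => (h.poisson i).zero
  filter_upwards [hz, h.path] with ω hz hpath i
  rw [Real.toNNReal_zero]
  exact ⟨hz i, hpath.start i⟩

theorem measureReal_eq_one_of_ae [IsProbabilityMeasure P] {p : Ω → Prop}
    (hp : ∀ᵐ ω ∂P, p ω) : P.real {ω | p ω} = 1 := by
  rw [← probReal_univ (μ := P)]
  refine measureReal_congr ?_
  filter_upwards [hp] with ω hω
  exact propext ⟨fun _ => trivial, fun _ => hω⟩

theorem measureReal_eq_zero_of_ae {p : Ω → Prop} (hp : ∀ᵐ ω ∂P, ¬ p ω) :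
    P.real {ω | p ω} = 0 := by
  exact (congrArg ENNReal.toReal (measure_eq_zero_iff_ae_notMem.2 hp)).trans ENNReal.toReal_zero

theorem IsParkingProcess.initial (h : IsParkingProcess P N m) :
    (∀ s, D P m s 0 = if s = 0 then 1 else 0) ∧ (∀ s, f P N m s 0 = if s = 0 then 1 else 0) ∧
      R P N m 0 = 0 ∧ D₃ P m 0 1 0 0 = 0 := by
  have := h.isProbabilityMeasure
  refine ⟨fun s => ?_, fun s => ?_, ?_, ?_⟩
  · unfold D
    split_ifs with hs
    · refine measureReal_eq_one_of_ae ?_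
      filter_upwards [h.ae_start] with ω hω
      rw [(hω 0).2, hs]
    · refine measureReal_eq_zero_of_ae ?_
      filter_upwards [h.ae_start] with ω hω
      rw [(hω 0).2]
      exact Ne.symm hs
  · rw [h.f_eq]
    split_ifs with hs
    · rw [measureReal_eq_one_of_ae]
      · simp
      · filter_upwards [h.ae_start] with ω hω
        exact ⟨(hω 0).1, by rw [(hω 1).2, hs]⟩
    · rw [measureReal_eq_zero_of_ae, mul_zero]
      filter_upwards [h.ae_start] with ω hω
      rw [(hω 1).2]
      exact fun hh => hs hh.2.symm
  · rw [h.R_eq, measureReal_eq_zero_of_ae, mul_zero]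
    filter_upwards [h.ae_start] with ω hω
    rw [(hω 1).2]
    exact fun hh => zero_ne_one hh.2.1
  · refine measureReal_eq_zero_of_ae ?_
    filter_upwards [h.ae_start] with ω hω
    rw [(hω 0).2]
    exact fun hh => zero_ne_one hh.2.1

/-- Conditioning on `N 0 = 0` multiplies by `exp t`. The term from differentiating this factor
cancels the loss caused by cars arriving at `0`. -/
theorem hasDerivWithinAt_exp_mul {φ q : ℝ → ℝ} {q' t : ℝ} (ht : 0 ≤ t)
    (hφ : ∀ t : ℝ, φ t = Real.exp t.toNNReal * q t)
    (hq : HasDerivWithinAt q q' (Set.Ici 0) t) :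
    HasDerivWithinAt φ (Real.exp t * q t + Real.exp t * q') (Set.Ici 0) t := by
  refine (((Real.hasDerivAt_exp t).hasDerivWithinAt).mul hq).congr (fun u hu => ?_) ?_
  · rw [hφ, Real.coe_toNNReal u hu]
    rfl
  · rw [hφ, Real.coe_toNNReal t ht]
    rfl

end TwoLineParking

end

theorem theorem1 {Ω : Type*} [MeasurableSpace Ω] (P : Measure Ω) [IsProbabilityMeasure P]
    (N : ℤ → ℝ≥0 → Ω → ℕ) (m : ℤ → ℝ≥0 → Ω → Fin 4)
    (h : TwoLineParking.IsParkingProcess P N m)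
    (D : Fin 4 → ℝ → ℝ) (hD : D = TwoLineParking.D P m)
    (D₃ : Fin 4 → Fin 4 → Fin 4 → ℝ → ℝ) (hD₃ : D₃ = TwoLineParking.D₃ P m)
    (f : Fin 4 → ℝ → ℝ) (hf : f = TwoLineParking.f P N m)
    (R : ℝ → ℝ) (hR : R = TwoLineParking.R P N m) :
    -- the single-site densities
    (∀ t : ℝ, 0 ≤ t →
      HasDerivWithinAt (D 0)
        (-(f 0 t + f 2 t) ^ 2 * Real.exp (-t)
          - (2 * f 0 t * f 1 t + f 1 t ^ 2) * Real.exp (-t)) (Set.Ici 0) t ∧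
      HasDerivWithinAt (D 1)
        ((f 0 t + f 2 t) ^ 2 * Real.exp (-t) - D₃ 0 1 0 t) (Set.Ici 0) t ∧
      HasDerivWithinAt (D 2)
        ((2 * f 0 t * f 1 t + f 1 t ^ 2) * Real.exp (-t)) (Set.Ici 0) t ∧
      HasDerivWithinAt (D 3) (D₃ 0 1 0 t) (Set.Ici 0) t) ∧
    (D 0 0 = 1 ∧ D 1 0 = 0 ∧ D 2 0 = 0 ∧ D 3 0 = 0) ∧
    -- the one-sided densities
    (∀ t : ℝ, 0 ≤ t →
      HasDerivWithinAt (f 0)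
        (-f 0 t * Real.exp (-t) - f 1 t * Real.exp (-t) - f 2 t * Real.exp (-t)) (Set.Ici 0) t ∧
      HasDerivWithinAt (f 1)
        (f 0 t * Real.exp (-t) + f 2 t * Real.exp (-t) - R t) (Set.Ici 0) t ∧
      HasDerivWithinAt (f 2) (f 1 t * Real.exp (-t)) (Set.Ici 0) t ∧
      HasDerivWithinAt R
        (f 0 t * (Real.exp (-t) - t * Real.exp (-2 * t))
          - f 1 t * t * Real.exp (-2 * t) - R t) (Set.Ici 0) t) ∧
    (f 0 0 = 1 ∧ f 1 0 = 0 ∧ f 2 0 = 0 ∧ R 0 = 0) ∧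
    -- the triple density
    (∀ t : ℝ, 0 ≤ t →
      HasDerivWithinAt (D₃ 0 1 0)
        (f 0 t ^ 2 * Real.exp (-t) - D₃ 0 1 0 t
          - 2 * R t * f 0 t * Real.exp (-t) - 2 * R t * f 1 t * Real.exp (-t)) (Set.Ici 0) t) ∧
    D₃ 0 1 0 0 = 0 := by
  subst hD hD₃ hf hR
  obtain ⟨i1, i2, i3, i4⟩ := h.initial
  have hT : ∀ {t : ℝ}, 0 ≤ t → ((t.toNNReal : ℝ≥0) : ℝ) = t := fun ht => Real.coe_toNNReal _ ht
  refine ⟨fun t ht => ⟨?_, ?_, ?_, ?_⟩, by simp [i1], fun t ht => ?_, by simp [i2, i3],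
    fun t ht => ?_, i4⟩
  · refine (h.hasDerivWithinAt_D 0 ht).congr_deriv ?_
    rw [h.measureReal_arrive_eq_zero, hT ht]
    ring
  · refine (h.hasDerivWithinAt_D 1 ht).congr_deriv ?_
    rw [h.measureReal_arrive_eq_one, hT ht]
    ring
  · refine (h.hasDerivWithinAt_D 2 ht).congr_deriv ?_
    rw [h.measureReal_arrive_eq_two, hT ht]
    ring
  · refine (h.hasDerivWithinAt_D 3 ht).congr_deriv ?_
    rw [h.measureReal_arrive_eq_three]
    ring
  · have hE : Real.exp t * Real.exp (-t) = 1 := by rw [← Real.exp_add]; simp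
    have hE2 : Real.exp (-2 * t) = Real.exp (-t) ^ 2 := by
      rw [← Real.exp_nat_mul]
      push_cast
      ring_nf
    refine ⟨?_, ?_, ?_, ?_⟩
    · refine (TwoLineParking.hasDerivWithinAt_exp_mul ht (h.f_eq 0)
        (h.hasDerivWithinAt_q 0 ht)).congr_deriv ?_
      rw [h.measureReal_half_arrive_eq_zero, hT ht]
      linear_combination (-(TwoLineParking.f P N m 0 t + TwoLineParking.f P N m 1 t +
        TwoLineParking.f P N m 2 t) * Real.exp (-t)) * hE
    · refine (TwoLineParking.hasDerivWithinAt_exp_mul ht (h.f_eq 1)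
        (h.hasDerivWithinAt_q 1 ht)).congr_deriv ?_
      rw [h.measureReal_half_arrive_eq_one, h.R_eq, hT ht]
      linear_combination ((TwoLineParking.f P N m 0 t + TwoLineParking.f P N m 2 t) *
        Real.exp (-t)) * hE
    · refine (TwoLineParking.hasDerivWithinAt_exp_mul ht (h.f_eq 2)
        (h.hasDerivWithinAt_q 2 ht)).congr_deriv ?_
      rw [h.measureReal_half_arrive_eq_two, hT ht]
      linear_combination (TwoLineParking.f P N m 1 t * Real.exp (-t)) * hE
    · refine (TwoLineParking.hasDerivWithinAt_exp_mul ht h.R_eq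
        (h.hasDerivWithinAt_q₂ ht)).congr_deriv ?_
      rw [h.measureReal_half_arrive_gain, h.measureReal_half_arrive_loss, h.R_eq, hT ht, hE2]
      linear_combination (TwoLineParking.f P N m 0 t * Real.exp (-t) -
        (TwoLineParking.f P N m 0 t + TwoLineParking.f P N m 1 t) * t * Real.exp (-t) ^ 2) * hE
  · refine (h.hasDerivWithinAt_D₃ ht).congr_deriv ?_
    rw [h.measureReal_triple_gain, h.measureReal_triple_left_loss,
      h.measureReal_triple_right_loss, hT ht]
    ring
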